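/- Let $k$ be a field of characteristic $0$, let $\mathfrak g$ be a finite-dimensional split semisimple Lie algebra over $k$ with splitting Cartan subalgebra $\mathfrak h$ and root system $\Delta$, let $\{\alpha_i\}_{i\in I}$, $I=\{1,\dots,r\}$, be a root basis of $\Delta$ with corresponding simple coroots $h_i\in\mathfrak h$, fundamental weights $\varpi_i\in\mathfrak h^*$ (so $\varpi_i(h_j)=\delta_{ij}$) and set of positive roots $\Delta_+$. Let $A$ be a commutative associative unital $k$-algebra, and let $L=\mathfrak g\otimes_k A$ be the map algebra, with bracket $[x\otimes a,y\otimes b]=[x,y]\otimes ab$; identify $x \in \mathfrak g$ with $x\otimes 1$. For $\alpha\in\mathfrak h^*$ put $L_\alpha=\{l\in L:[h,l]=\alpha(h)l\ \text{for all } h\in\mathfrak h\}$ and let $L_+=\sum_{\alpha\in\Delta_+}L_\alpha$. Then $h_i(a):=h_i\otimes a\in L_0$ for $a\in A$. Let $U(L)_0$ be the subalgebra of elements of $U(L)$ commuting with $\mathfrak h$, and let $\pi_0:U(L)_0\to U(L_0)$ be the Harish-Chandra homomorphism, i.e. the projection with kernel $U(L)L_+\cap U(L)_0$ in the decomposition $U(L)_0=U(L_0)\oplus\big(U(L)L_+\cap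 U(L)_0\big)$. For a dominant integral weight $\lambda=\sum_{i\in I}\ell_i\varpi_i$, $\ell_i\in\mathbb N=\{0,1,2,\dots\}$, let $J^\lambda$ be the two-sided ideal of $U(L_0)$ generated, for all $i\in I$, by the elements (i) $\pi_0(x_1\cdots x_m\,y_1\cdots y_{\ell_i+1})$, where $x_q\in L_{\beta_q}$, $\beta_q\in\Delta_+$, $\sum_{q=1}^m\beta_q=(\ell_i+1)\alpha_i$ and $y_q\in L_{-\alpha_i}$, and (ii) $h_i-\ell_i 1$. The Seligman–Chari–Pressley algebra is $S^\lambda(L,\mathfrak g)=U(L_0)/J^\lambda$. For $\ell\in\mathbb N$ let $\mathrm{TS}^\ell(A)$ be the subalgebra of $A^{\otimes\ell}$ (with factorwise product; $A^{\otimes 0}=k$) consisting of the tensors fixed by all permutations of the $\ell$ factors, and for $a\in A$ let $\mathrm{sym}_\ell(a)=\sum_{i=1}^{\ell}1^{\otimes (i-1)}\otimes a\otimes 1^{\otimes(\ell-i)}\in \mathrm{TS}^\ell(A)$. **Theorem.** There exists an isomorphism of unital associative $k$-algebras $$S^\lambda(L,\mathfrak g)\;\longrightarrow\;\mathrm{TS}^\lambda(A):=\mathrm{TS}^{\ell_1}(A)\otimes_k\cdots\otimes_k\mathrm{TS}^{\ell_r}(A)$$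 (the target being the tensor product of the commutative associative algebras $\mathrm{TS}^{\ell_i}(A)$) which, for all $i\in I$ and $a\in A$, sends the class of $h_i(a)$ to $1\otimes\cdots\otimes1\otimes\mathrm{sym}_{\ell_i}(a)\otimes1\otimes\cdots\otimes1$, with $\mathrm{sym}_{\ell_i}(a)$ in the $i$-th factor. -/

import Mathlib

open scoped TensorProduct

noncomputable section

/-! ### Symmetric tensor algebras -/

namespace SymTensor

variable (k A : Type*) [CommRing k] [CommRing A] [Algebra k A]

/-- The place permutation `a₁ ⊗ ⋯ ⊗ a_ℓ ↦ a_{σ⁻¹(1)} ⊗ ⋯ ⊗ a_{σ⁻¹(ℓ)}` of `A^{⊗ ℓ}`. -/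
def perm (l : ℕ) (σ : Equiv.Perm (Fin l)) : (⨂[k] _ : Fin l, A) ≃ₗ[k] (⨂[k] _ : Fin l, A) :=
  PiTensorProduct.reindex k (fun _ : Fin l => A) σ

theorem perm_tprod (l : ℕ) (σ : Equiv.Perm (Fin l)) (a : Fin l → A) :
    perm k A l σ (PiTensorProduct.tprod k a) = PiTensorProduct.tprod k (fun i => a (σ⁻¹ i)) :=
  PiTensorProduct.reindex_tprod σ a

theorem perm_mul (l : ℕ) (σ : Equiv.Perm (Fin l)) (s t : ⨂[k] _ : Fin l, A) :
    perm k A l σ (s * t) = perm k A l σ s * perm k A l σ t := by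
  revert s t
  refine (LinearMap.map_mul_iff (perm k A l σ).toLinearMap).mpr ?_
  ext x y
  simp [perm_tprod, PiTensorProduct.tprod_mul_tprod]
  rfl

/-- `TS^ℓ(A)`: the subalgebra of symmetric tensors in `A^{⊗ ℓ}`, for the factorwise product. -/
def TS (l : ℕ) : Subalgebra k (⨂[k] _ : Fin l, A) where
  carrier := {t | ∀ σ : Equiv.Perm (Fin l), perm k A l σ t = t}
  mul_mem' {s t} hs ht σ := by rw [perm_mul, hs σ, ht σ]
  add_mem' {s t} hs ht σ := by rw [map_add, hs σ, ht σ]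
  algebraMap_mem' r σ := by
    rw [Algebra.algebraMap_eq_smul_one, map_smul]
    congr 1
    exact perm_tprod k A l σ 1

variable {A}

/-- `s_i(a) = 1 ⊗ ⋯ ⊗ 1 ⊗ a ⊗ 1 ⊗ ⋯ ⊗ 1`, with `a` in position `i`. -/
def place (l : ℕ) (i : Fin l) (a : A) : ⨂[k] _ : Fin l, A :=
  PiTensorProduct.tprod k (fun j => if j = i then a else 1)

theorem perm_place (l : ℕ) (σ : Equiv.Perm (Fin l)) (i : Fin l) (a : A) :
    perm k A l σ (place k l i a) = place k l (σ i) a := by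
  rw [place, perm_tprod, place]
  congr 1
  ext q
  simp only [Equiv.Perm.inv_eq_iff_eq]

/-- The symmetrization map `sym_ℓ(a) = ∑_i s_i(a)`, with values in `TS^ℓ(A)`. -/
def sym (l : ℕ) (a : A) : TS k A l :=
  ⟨∑ i, place k l i a, fun σ => by
    rw [map_sum]
    simp only [perm_place]
    exact Equiv.sum_comp σ fun i => place k l i a⟩

end SymTensor

/-! ### The Seligman algebra

Throughout, `𝔤` is a finite-dimensional split semisimple Lie algebra over a field `k` of
characteristic zero, `H` is a splitting Cartan subalgebra, `b` is a root basis, and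
`j : 𝔤 → L` is the (inclusion) homomorphism into a Lie algebra `L`. -/

namespace Seligman

open LieAlgebra.IsKilling Module

section General

variable {k 𝔤 L : Type*} [Field k] [LieRing 𝔤] [LieAlgebra k 𝔤] [LieRing L] [LieAlgebra k L]

/-- The weight space `L_α = {l | [h, l] = α(h) l for all h ∈ H}`. -/
def wtSpace (j : 𝔤 →ₗ⁅k⁆ L) (H : LieSubalgebra k 𝔤) (α : Dual k H) : Submodule k L where
  carrier := {l | ∀ h : H, ⁅j h, l⁆ = α h • l}
  add_mem' {x y} hx hy h := by rw [lie_add, hx h, hy h, smul_add]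
  zero_mem' h := by simp
  smul_mem' c x hx h := by rw [lie_smul, hx h, smul_comm]

/-- The subalgebra `L₀`, i.e. the weight space for the weight `0`. -/
def zeroPart (j : 𝔤 →ₗ⁅k⁆ L) (H : LieSubalgebra k 𝔤) : LieSubalgebra k L where
  toSubmodule := wtSpace j H 0
  lie_mem' {x y} hx hy h := by
    have hx' : ⁅j h, x⁆ = 0 := by simpa using hx h
    have hy' : ⁅j h, y⁆ = 0 := by simpa using hy h
    rw [leibniz_lie, hx', hy']
    simp

/-- The natural homomorphism `U(L₀) → U(L)`. -/
def envIncl (j : 𝔤 →ₗ⁅k⁆ L) (H : LieSubalgebra k 𝔤) :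
    UniversalEnvelopingAlgebra k (zeroPart j H) →ₐ[k] UniversalEnvelopingAlgebra k L :=
  letI : LieRing (UniversalEnvelopingAlgebra k L) := LieRing.ofAssociativeRing
  UniversalEnvelopingAlgebra.lift k
    ((UniversalEnvelopingAlgebra.ι k : L →ₗ⁅k⁆ UniversalEnvelopingAlgebra k L).comp
      (zeroPart j H).incl)

/-- `U(L)₀`, the elements of `U(L)` of weight `0` for the adjoint action of `H`. -/
def envZero (j : 𝔤 →ₗ⁅k⁆ L) (H : LieSubalgebra k 𝔤) :
    Subalgebra k (UniversalEnvelopingAlgebra k L) :=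
  Subalgebra.centralizer k (Set.range fun h : H => UniversalEnvelopingAlgebra.ι k (j h))

/-- `L₊ = ∑_{α ∈ Θ₊} L_α`, for a set `Θ₊` of positive roots. -/
def posPart (j : 𝔤 →ₗ⁅k⁆ L) (H : LieSubalgebra k 𝔤) (Θp : Set (Dual k H)) : Submodule k L :=
  ⨆ α ∈ Θp, wtSpace j H α

/-- The left ideal `U(L) L₊` of `U(L)`. -/
def envPos (j : 𝔤 →ₗ⁅k⁆ L) (H : LieSubalgebra k 𝔤) (Θp : Set (Dual k H)) :
    Submodule (UniversalEnvelopingAlgebra k L) (UniversalEnvelopingAlgebra k L) :=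
  Submodule.span _ (UniversalEnvelopingAlgebra.ι k '' (posPart j H Θp : Set L))

/-- The kernel `K = U(L) L₊ ∩ U(L)₀` of the Harish-Chandra homomorphism. -/
def hcKer (j : 𝔤 →ₗ⁅k⁆ L) (H : LieSubalgebra k 𝔤) (Θp : Set (Dual k H)) :
    Submodule k (UniversalEnvelopingAlgebra k L) :=
  (envPos j H Θp).restrictScalars k ⊓ Subalgebra.toSubmodule (envZero j H)

/-- The graph of the Harish-Chandra homomorphism `π₀ : U(L)₀ → U(L₀)`: this is the projection
along `K` in the decomposition `U(L)₀ = U(L₀) ⊕ K`, so that `π₀(v) = u` holds if and only if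
`v` lies in `U(L)₀` and `v - u` lies in `K`. -/
def IsHarishChandra (j : 𝔤 →ₗ⁅k⁆ L) (H : LieSubalgebra k 𝔤) (Θp : Set (Dual k H))
    (v : UniversalEnvelopingAlgebra k L)
    (u : UniversalEnvelopingAlgebra k (zeroPart j H)) : Prop :=
  v ∈ envZero j H ∧ v - envIncl j H u ∈ hcKer j H Θp

end General

section Split

variable {k 𝔤 L : Type*} [Field k] [CharZero k] [LieRing 𝔤] [LieAlgebra k 𝔤]
  [FiniteDimensional k 𝔤] [LieAlgebra.IsSemisimple k 𝔤]
  {H : LieSubalgebra k 𝔤} [H.IsCartanSubalgebra] [LieModule.IsTriangularizable k H 𝔤]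
  [LieRing L] [LieAlgebra k L]

/-- The fundamental weight `ϖ_i`: `ϖ_i(h_j) = δ_{ij}` for the simple coroots `h_j`. -/
def fundamentalWeight (b : (rootSystem H).Base) (i : b.support) : Dual k H :=
  b.toCoweightBasis.coord i

open Classical in
theorem fundamentalWeight_coroot (b : (rootSystem H).Base) (i i' : b.support) :
    fundamentalWeight b i ((rootSystem H).coroot i') = if i = i' then 1 else 0 := by
  rw [fundamentalWeight, ← b.toCoweightBasis_apply, Basis.coord_apply, Basis.repr_self,
    Finsupp.single_apply]
  simp only [eq_comm]

/-- The positive roots `Δ₊ = Δ ∩ Q₊` of `𝔤`, where `Q₊` is the additive monoid generated by the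
simple roots. -/
def posRoots (b : (rootSystem H).Base) : Set (Dual k H) :=
  Set.range (rootSystem H).root ∩ AddSubmonoid.closure ((rootSystem H).root '' b.support)

theorem map_mem_zeroPart (j : 𝔤 →ₗ⁅k⁆ L) (h : H) : j h ∈ zeroPart j H := by
  intro h'
  have : ⁅(h' : 𝔤), (h : 𝔤)⁆ = 0 := by
    simpa using congrArg Subtype.val (trivial_lie_zero H H h' h)
  simp [← LieHom.map_lie, this]

/-- The generators `G_i`, `i ∈ I`, of the ideal `J^λ`. The natural number `l` is `ℓ_i = λ(h_i)`. -/
inductive IsGenerator (b : (rootSystem H).Base) (j : 𝔤 →ₗ⁅k⁆ L) (Θp : Set (Dual k H))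
    (lam : Dual k H) : UniversalEnvelopingAlgebra k (zeroPart j H) → Prop
  /-- `π₀(x₁ ⋯ x_m y₁ ⋯ y_{ℓ_i + 1})` for `x_q ∈ L_{β_q}` with `β_q ∈ Θ₊`, for `y_q ∈ L_{-α_i}`,
  and `∑ β_q = (ℓ_i + 1) α_i`. -/
  | hc (i : b.support) (l : ℕ) (hl : lam ((rootSystem H).coroot i) = l)
      (m : ℕ) (β : Fin m → Dual k H) (x : Fin m → L) (y : Fin (l + 1) → L)
      (hβ : ∀ q, β q ∈ Θp) (hx : ∀ q, x q ∈ wtSpace j H (β q))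
      (hy : ∀ q, y q ∈ wtSpace j H (-(rootSystem H).root i))
      (hsum : ∑ q, β q = (l + 1) • (rootSystem H).root i)
      (u : UniversalEnvelopingAlgebra k (zeroPart j H))
      (hu : IsHarishChandra j H Θp
        ((List.ofFn fun q => UniversalEnvelopingAlgebra.ι k (x q)).prod *
          (List.ofFn fun q => UniversalEnvelopingAlgebra.ι k (y q)).prod) u) :
      IsGenerator b j Θp lam u
  /-- `h_i - ℓ_i 1`. -/
  | wt (i : b.support) :
      IsGenerator b j Θp lam
        (UniversalEnvelopingAlgebra.ι k
            (⟨j ((rootSystem H).coroot i), map_mem_zeroPart j _⟩ : zeroPart j H) -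
          algebraMap k _ (lam ((rootSystem H).coroot i)))

/-- The two-sided ideal `J^λ` of `U(L₀)`. -/
def ideal (b : (rootSystem H).Base) (j : 𝔤 →ₗ⁅k⁆ L) (Θp : Set (Dual k H)) (lam : Dual k H) :
    TwoSidedIdeal (UniversalEnvelopingAlgebra k (zeroPart j H)) :=
  TwoSidedIdeal.span {u | IsGenerator b j Θp lam u}

/-- The Seligman (or Seligman–Chari–Pressley) algebra `S^λ(L, 𝔤) = U(L₀) / J^λ`. -/
abbrev Alg (b : (rootSystem H).Base) (j : 𝔤 →ₗ⁅k⁆ L) (Θp : Set (Dual k H)) (lam : Dual k H) :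
    Type _ :=
  (ideal b j Θp lam).ringCon.Quotient

/-- The canonical map `U(L₀) → S^λ(L, 𝔤)`. -/
def can (b : (rootSystem H).Base) (j : 𝔤 →ₗ⁅k⁆ L) (Θp : Set (Dual k H)) (lam : Dual k H) :
    UniversalEnvelopingAlgebra k (zeroPart j H) →ₐ[k] Alg b j Θp lam :=
  RingCon.mkₐ k (ideal b j Θp lam).ringCon

end Split

/-! ### Map algebras -/

section MapAlgebra

/-- The embedding `x ↦ 1 ⊗ x` of `𝔤` into the map algebra; the tensor factors are written in the
order `A ⊗ 𝔤`, and the Lie bracket is `[a ⊗ x, a' ⊗ x'] = a a' ⊗ [x, x']`. -/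
def mapIncl (k A 𝔤 : Type*) [Field k] [CommRing A] [Algebra k A] [LieRing 𝔤] [LieAlgebra k 𝔤] :
    𝔤 →ₗ⁅k⁆ A ⊗[k] 𝔤 :=
  { TensorProduct.mk k A 𝔤 1 with
    map_lie' := by
      intro x y
      simp [LieAlgebra.ExtendScalars.bracket_tmul] }

variable {k A 𝔤 : Type*} [Field k] [CharZero k] [CommRing A] [Algebra k A]
  [LieRing 𝔤] [LieAlgebra k 𝔤] [FiniteDimensional k 𝔤] [LieAlgebra.IsSemisimple k 𝔤]
  {H : LieSubalgebra k 𝔤} [H.IsCartanSubalgebra] [LieModule.IsTriangularizable k H 𝔤]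

/-- The element `h_i(a) = h_i ⊗ a` of `L₀`, for `L` the map algebra. -/
def hElem (b : (rootSystem H).Base) (i : b.support) (a : A) : zeroPart (mapIncl k A 𝔤) H :=
  ⟨a ⊗ₜ[k] (((rootSystem H).coroot i : H) : 𝔤), by
    intro h
    have h0 : ⁅(h : 𝔤), (((rootSystem H).coroot i : H) : 𝔤)⁆ = 0 := by
      simpa using congrArg Subtype.val (trivial_lie_zero H H h ((rootSystem H).coroot i))
    change ⁅(1 : A) ⊗ₜ[k] (h : 𝔤), a ⊗ₜ[k] (((rootSystem H).coroot i : H) : 𝔤)⁆ = _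
    rw [LieAlgebra.ExtendScalars.bracket_tmul, h0]
    simp⟩

/-- The tensor product algebra `TS^λ(A) = ⨂_{i ∈ I} TS^{ℓ_i}(A)`, for `λ = ∑ ℓ_i ϖ_i`. -/
abbrev TSAlg (k A : Type*) [Field k] [CommRing A] [Algebra k A] {I : Type*} (l : I → ℕ) : Type _ :=
  ⨂[k] i : I, SymTensor.TS k A (l i)

open Classical in
/-- The pure tensor `1 ⊗ ⋯ ⊗ 1 ⊗ t ⊗ 1 ⊗ ⋯ ⊗ 1` with `t` in the factor `i`. -/
def inFactor {I : Type*} (l : I → ℕ) (i : I) (t : SymTensor.TS k A (l i)) : TSAlg k A l :=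
  PiTensorProduct.tprod k (Function.update 1 i t)

end MapAlgebra

end Seligman

end

set_option linter.unusedSectionVars false

noncomputable section

namespace SymTensor

/-! ### Polarized elementary symmetric functions of a power-sum map. -/

section Psi

variable {k A C : Type*} [CommRing k] [CommRing A] [Algebra k A] [Ring C] [Algebra k C]

/-! Think of `h_i(a)` as the power sum of `a` over `ℓ_i` points: this is literally what `sym_ℓ(a)`
is, the points being the `ℓ` place embeddings of `A`. Newton's recursion turns a power-sum map `h`
into polarized elementary symmetric functions Ψ_n (`psi`), and the theorem says that both algebras
are cut out by `h_i(1) = ℓ_i` and Ψ_{ℓ_i+1} = 0.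

For `TS^ℓ(A)`: Ψ_n of a sum of points is a sum over injections (`psi_sum_points`), so Ψ_{ℓ+1}
vanishes and Ψ_ℓ is full symmetrization. In characteristic zero the elements `sym_ℓ(a)` therefore
generate (`adjoin_sym`), and Ψ_ℓ / ℓ! defines a homomorphism to any algebra in which the relations
hold (`exists_lift`).

For the Seligman algebra: positive roots summing to a multiple of `α_i` all equal `α_i`
(`eq_simple_of_sum_eq`), so only the map algebra of an 𝔰𝔩₂ matters. Modulo `U(L) L₊`, the product
`e(1)ⁿ f(b₁)⋯f(b_n)` becomes n! Ψ_n(b), and with arbitrary `e(a_q)` one still lands in the span of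
the values of Ψ_n (`pow_smul_ordProd_smul`, `exists_psi_smul`). Hence the generators (i) amount to
Ψ_{ℓ_i+1} = 0.

A Harish-Chandra image is thus known only up to `U(L₀) ∩ U(L) L₊`. Instead of deducing from
Poincaré–Birkhoff–Witt that this intersection is zero, it is enough that the map `U(L₀) → TS^λ(A)`
kills it. After embedding `TS^λ(A)` in the full tensor algebra, that map is the weight of a highest
weight vector in an explicit module of polynomials on upper unipotent matrices
(`eq_zero_of_envIncl_mem_envPos`), and a weight must vanish on whatever annihilates the vector. -/

theorem update_mul_eq {n : ℕ} (a : A) (b : Fin n → A) (j : Fin n) :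
    (fun i => (if i = j then LinearMap.mulLeft k a else LinearMap.id) (b i)) =
      Function.update b j (a * b j) := by
  ext i
  by_cases h : i = j
  · subst h; simp
  · simp [h]

/-- The polarized elementary symmetric function attached to a "power sum" map `h : A → C`: it is
determined by `Ψ() = 1` and
`Ψ(a, b₁, …, b_n) = h(a) Ψ(b₁, …, b_n) - ∑ⱼ Ψ(b₁, …, a bⱼ, …, b_n)`. -/
def psi (h : A →ₗ[k] C) : ∀ n : ℕ, MultilinearMap k (fun _ : Fin n => A) C
  | 0 => MultilinearMap.constOfIsEmpty k _ 1
  | n + 1 => LinearMap.uncurryLeft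
      { toFun := fun a => (LinearMap.mulLeft k (h a)).compMultilinearMap (psi h n) -
          ∑ j, (psi h n).compLinearMap
            (fun i => if i = j then LinearMap.mulLeft k a else LinearMap.id)
        map_add' := by
          intro a a'
          ext b
          simp only [sub_apply, add_apply, sum_apply,
            MultilinearMap.compLinearMap_apply, update_mul_eq, map_add, add_mul,
            LinearMap.compMultilinearMap_apply, LinearMap.mulLeft_apply,
            MultilinearMap.map_update_add, Finset.sum_add_distrib]
          abel
        map_smul' := by
          intro c a
          ext b
          simp only [sub_apply, smul_apply, sum_apply,
            MultilinearMap.compLinearMap_apply, update_mul_eq, map_smul, smul_mul_assoc,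
            LinearMap.compMultilinearMap_apply, LinearMap.mulLeft_apply, RingHom.id_apply,
            MultilinearMap.map_update_smul, Finset.smul_sum, smul_sub] }

@[simp]
theorem psi_zero (h : A →ₗ[k] C) (b : Fin 0 → A) : psi h 0 b = 1 := rfl

theorem psi_cons (h : A →ₗ[k] C) (n : ℕ) (a : A) (b : Fin n → A) :
    psi h (n + 1) (Fin.cons a b) =
      h a * psi h n b - ∑ j, psi h n (Function.update b j (a * b j)) := by
  simp only [psi, LinearMap.uncurryLeft_apply, Fin.cons_zero, Fin.tail_cons, LinearMap.coe_mk,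
    AddHom.coe_mk, sub_apply, sum_apply,
    MultilinearMap.compLinearMap_apply, update_mul_eq, LinearMap.compMultilinearMap_apply,
    LinearMap.mulLeft_apply]

theorem psi_map {C' : Type*} [Ring C'] [Algebra k C'] (f : C →ₐ[k] C') (h : A →ₗ[k] C) (n : ℕ)
    (b : Fin n → A) : f (psi h n b) = psi (f.toLinearMap ∘ₗ h) n b := by
  induction n with
  | zero => simp
  | succ n ih =>
    rw [← Fin.cons_self_tail b]
    simp only [psi_cons, map_sub, map_mul, map_sum, ih, LinearMap.comp_apply,
      AlgHom.toLinearMap_apply]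

theorem psi_one (h : A →ₗ[k] C) {l : ℕ} (h1 : h 1 = l) (n : ℕ) :
    psi h n 1 = (l.descFactorial n : C) := by
  induction n with
  | zero => simp
  | succ n ih =>
    have e : (1 : Fin (n + 1) → A) = Fin.cons 1 1 := (Fin.cons_self_tail _).symm
    have hu : ∀ j : Fin n, Function.update (1 : Fin n → A) j (1 * (1 : Fin n → A) j) = 1 := by
      intro j; simp
    rw [e, psi_cons]
    simp only [hu, ih, h1, Finset.sum_const, Finset.card_univ, Fintype.card_fin,
      Nat.descFactorial_succ, nsmul_eq_mul]
    -- The recursion contributes the factor l - n. Natural subtraction truncates it only for n > l,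
    -- where the descending factorial is already 0.
    rcases le_total n l with hnl | hnl
    · rw [Nat.cast_mul, Nat.cast_sub hnl, sub_mul]
    · rcases hnl.lt_or_eq with hlt | rfl
      · simp [Nat.descFactorial_of_lt hlt]
      · simp

theorem psi_mem (S : Subalgebra k C) (h : A →ₗ[k] C) (hS : ∀ a, h a ∈ S) (n : ℕ)
    (b : Fin n → A) : psi h n b ∈ S := by
  induction n with
  | zero => exact S.one_mem
  | succ n ih =>
    rw [← Fin.cons_self_tail b, psi_cons]
    exact S.sub_mem (S.mul_mem (hS _) (ih _)) (S.sum_mem fun j _ => ih _)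

/-- The function `Ψ` for a sum of algebra homomorphisms ("points"). -/
theorem psi_sum_points {D Q : Type*} [CommRing D] [Algebra k D] [Fintype Q] [DecidableEq Q]
    (s : Q → A →ₐ[k] D) (n : ℕ) (b : Fin n → A) :
    psi (∑ q, (s q).toLinearMap) n b =
      ∑ f : Fin n → Q with Function.Injective f, ∏ j, s (f j) (b j) := by
  induction n with
  | zero => simp [Function.injective_of_subsingleton]
  | succ n ih =>
    obtain ⟨a, b, rfl⟩ : ∃ a b', b = Fin.cons a b' := ⟨b 0, Fin.tail b, (Fin.cons_self_tail b).symm⟩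
    have hupd : ∀ (j : Fin n) (f : Fin n → Q),
        ∏ i, s (f i) (Function.update b j (a * b j) i) = s (f j) a * ∏ i, s (f i) (b i) := by
      intro j f
      rw [← Finset.mul_prod_erase _ _ (Finset.mem_univ j),
        ← Finset.mul_prod_erase (f := fun i => s (f i) (b i)) _ (Finset.mem_univ j)]
      simp only [Function.update_self, map_mul, mul_assoc]
      congr 2
      refine Finset.prod_congr rfl fun i hi => ?_
      rw [Function.update_of_ne (Finset.ne_of_mem_erase hi)]
    -- The subtracted terms are those where the new argument shares a point with an old one. What
    -- remains counts exactly the injective extensions of `f` by one value.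
    have hinj : ∀ f : Fin n → Q, Function.Injective f →
        ∑ q, s q a - ∑ j, s (f j) a = ∑ q with q ∉ Set.range f, s q a := by
      intro f hf
      rw [sub_eq_iff_eq_add, ← Finset.sum_filter_add_sum_filter_not Finset.univ
        (fun q => q ∉ Set.range f)]
      congr 1
      rw [← Finset.sum_image (f := fun q => s q a) (g := f) (s := Finset.univ) (fun x _ y _ h => hf h)]
      refine Finset.sum_congr ?_ fun _ _ => rfl
      ext q; simp
    rw [psi_cons, ih]
    simp only [ih, hupd]
    rw [Finset.sum_comm, Finset.mul_sum, ← Finset.sum_sub_distrib]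
    simp only [← Finset.sum_mul, ← sub_mul, LinearMap.sum_apply, AlgHom.toLinearMap_apply]
    rw [Finset.sum_congr rfl (fun f hf => by rw [hinj f (Finset.mem_filter.1 hf).2])]
    rw [Finset.sum_filter, Finset.sum_filter]
    rw [← (Fin.consEquiv (fun _ : Fin (n+1) => Q)).sum_comp, Fintype.sum_prod_type_right]
    refine Finset.sum_congr rfl fun f _ => ?_
    split_ifs with hf
    · rw [Finset.sum_mul, Finset.sum_filter]
      refine Finset.sum_congr rfl fun q _ => ?_
      simp [Fin.consEquiv, Fin.cons_injective_iff, hf, Fin.prod_univ_succ]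
    · symm
      refine Finset.sum_eq_zero fun q _ => ?_
      simp [Fin.consEquiv, Fin.cons_injective_iff, hf]

theorem psi_eq_zero {D Q : Type*} [CommRing D] [Algebra k D] [Fintype Q]
    (s : Q → A →ₐ[k] D) {n : ℕ} (hn : Fintype.card Q < n) (b : Fin n → A) :
    psi (∑ q, (s q).toLinearMap) n b = 0 := by
  classical
  rw [psi_sum_points, Finset.sum_eq_zero]
  intro f hf
  have := Fintype.card_le_of_injective f (Finset.mem_filter.1 hf).2
  simp at this
  omega

end Psi

/-! ### Generators and relations for symmetric tensors in characteristic zero. -/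

section Presentation

variable (k : Type*) {A C : Type*} [Field k] [CommRing A] [Algebra k A]
  [Ring C] [Algebra k C]

/-- The map `a ↦ 1 ⊗ ⋯ ⊗ a ⊗ ⋯ ⊗ 1` as a homomorphism of algebras. -/
abbrev placeHom (l : ℕ) (i : Fin l) : A →ₐ[k] ⨂[k] _ : Fin l, A :=
  PiTensorProduct.singleAlgHom (R := k) (A := fun _ : Fin l => A) i

theorem placeHom_apply (l : ℕ) (i : Fin l) (a : A) : placeHom k l i a = place k l i a := by
  simp only [place, PiTensorProduct.singleAlgHom_apply]
  congr 1
  ext j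
  by_cases h : j = i
  · subst h; simp
  · simp [h]

theorem place_mul_tprod (l : ℕ) (i : Fin l) (a : A) (b : Fin l → A) :
    place k l i a * PiTensorProduct.tprod k b =
      PiTensorProduct.tprod k (Function.update b i (a * b i)) := by
  rw [place, PiTensorProduct.tprod_mul_tprod]
  congr 1
  ext j
  by_cases h : j = i
  · subst h; simp
  · simp [h]

theorem prod_place (l : ℕ) (a : Fin l → A) :
    ∏ j, placeHom k l j (a j) = PiTensorProduct.tprod k a := by
  have := map_prod (PiTensorProduct.tprodMonoidHom k (A := fun _ : Fin l => A))
    (fun j => Pi.mulSingle j (a j)) Finset.univ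
  rw [Finset.univ_prod_mulSingle] at this
  exact this.symm

theorem prod_place_perm (l : ℕ) (σ : Equiv.Perm (Fin l)) (a : Fin l → A) :
    ∏ j, placeHom k l (σ j) (a j) = perm k A l σ (PiTensorProduct.tprod k a) := by
  rw [perm_tprod, ← prod_place,
    ← Equiv.prod_comp σ (fun j => placeHom k l j (a (σ⁻¹ j)))]
  refine Finset.prod_congr rfl fun j _ => ?_
  rw [show σ⁻¹ (σ j) = j from σ.symm_apply_apply j]

/-- The symmetrization map as a linear map. -/
def symLin (l : ℕ) : A →ₗ[k] TS k A l where
  toFun := sym k l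
  map_add' a b := by
    ext
    simp only [sym, ← placeHom_apply, map_add, Finset.sum_add_distrib]
    rfl
  map_smul' c a := by
    ext
    simp only [sym, ← placeHom_apply, map_smul, ← Finset.smul_sum]
    rfl

@[simp]
theorem symLin_apply (l : ℕ) (a : A) : symLin k l a = sym k l a := rfl

theorem val_comp_symLin (l : ℕ) :
    (TS k A l).val.toLinearMap ∘ₗ symLin k l = ∑ q, (placeHom (A := A) k l q).toLinearMap := by
  ext a
  simp [sym, ← placeHom_apply]

theorem sym_one (l : ℕ) : sym k l (1 : A) = l := by
  ext
  simp only [sym, ← placeHom_apply, map_one]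
  simp

/-- An injection of `Fin l` into the l places is a permutation, so the sum over injections is the
symmetrization. -/
theorem psi_sym (l : ℕ) (a : Fin l → A) :
    ((psi (symLin k l) l a : TS k A l) : ⨂[k] _ : Fin l, A) =
      ∑ σ : Equiv.Perm (Fin l), perm k A l σ (PiTensorProduct.tprod k a) := by
  classical
  have := psi_map (TS k A l).val (symLin k l) l a
  rw [val_comp_symLin, psi_sum_points] at this
  refine this.trans ?_
  simp only [← prod_place_perm]
  rw [Finset.sum_filter]
  symm
  rw [← Finset.sum_filter]
  refine Finset.sum_bij (fun σ _ => σ) (fun σ _ => by simpa using σ.injective)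
    (fun σ _ τ _ h => DFunLike.coe_injective h) (fun f hf => ?_) (fun _ _ => rfl)
  exact ⟨Equiv.ofBijective f (Finite.injective_iff_bijective.1 (Finset.mem_filter.1 hf).2),
    Finset.mem_univ _, rfl⟩

/-- Pigeonhole: l + 1 arguments cannot be placed injectively in l places. -/
theorem psi_sym_succ (l : ℕ) (a : Fin (l + 1) → A) : psi (symLin k l) (l + 1) a = 0 := by
  have := psi_map (TS k A l).val (symLin k l) (l + 1) a
  rw [val_comp_symLin, psi_eq_zero _ (by simp)] at this
  exact Subtype.ext this

variable [CharZero k]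

/-- In characteristic zero, `TS^l(A)` is generated by the elements `sym_l(a)`. -/
theorem adjoin_sym (l : ℕ) : Algebra.adjoin k (Set.range (sym k (A := A) l)) = ⊤ := by
  rw [eq_top_iff]
  rintro t -
  have key : ∀ x : ⨂[k] _ : Fin l, A, ∑ σ : Equiv.Perm (Fin l), perm k A l σ x ∈
      (Algebra.adjoin k (Set.range (sym k (A := A) l))).map (TS k A l).val := by
    intro x
    induction x using PiTensorProduct.induction_on with
    | smul_tprod r a =>
      simp only [map_smul, ← Finset.smul_sum]
      refine Subalgebra.smul_mem _ ?_ r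
      rw [← psi_sym]
      refine ⟨_, psi_mem _ (symLin k l) (fun a => ?_) l a, rfl⟩
      exact Algebra.subset_adjoin ⟨a, rfl⟩
    | add x y hx hy =>
      simp only [map_add, Finset.sum_add_distrib]
      exact Subalgebra.add_mem _ hx hy
  -- A symmetric tensor is 1/l! times its own symmetrization, and symmetrizations are values of Ψ_l,
  -- hence polynomials in the `sym`.
  have h2 : ∑ σ : Equiv.Perm (Fin l), perm k A l σ t = (l.factorial : k) • (t : ⨂[k] _ : Fin l, A) := by
    rw [Finset.sum_congr rfl fun σ _ => t.2 σ]
    simp [Fintype.card_perm, Nat.cast_smul_eq_nsmul]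
  obtain ⟨s, hs, hst⟩ := key t
  have hs' : s = (l.factorial : k) • t := Subtype.ext (hst.trans h2)
  have : t = (l.factorial : k)⁻¹ • s := by
    rw [hs', smul_smul, inv_mul_cancel₀ (by exact_mod_cast l.factorial_ne_zero), one_smul]
  rw [this]
  exact Subalgebra.smul_mem _ hs _

variable {k}

/-- The presentation of `TS^l(A)` in characteristic zero: a linear map `h : A → C` with
`h(1) = l` and `Ψ_{l+1} = 0` extends along `sym_l` to a homomorphism of algebras. -/
theorem exists_lift (l : ℕ) (h : A →ₗ[k] C) (h1 : h 1 = l)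
    (hpsi : ∀ b, psi h (l + 1) b = 0) :
    ∃ χ : TS k A l →ₐ[k] C, ∀ a, χ (sym k l a) = h a := by
  let g : (⨂[k] _ : Fin l, A) →ₗ[k] C := (l.factorial : k)⁻¹ • PiTensorProduct.lift (psi h l)
  have hl : (l.factorial : k) ≠ 0 := by exact_mod_cast l.factorial_ne_zero
  have g1 : g 1 = 1 := by
    have : PiTensorProduct.lift (psi h l) 1 = (l.factorial : k) • (1 : C) := by
      rw [PiTensorProduct.one_def, PiTensorProduct.lift.tprod, psi_one h h1,
        Nat.descFactorial_self, Nat.cast_smul_eq_nsmul, nsmul_eq_mul, mul_one]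
    rw [LinearMap.smul_apply, this, smul_smul, inv_mul_cancel₀ hl, one_smul]
  -- By the recursion, Ψ_{l+1}(a, b) = 0 is precisely this identity on pure tensors. It gives
  -- multiplicativity when one factor is a generator, whence in general.
  have gsym : ∀ (a : A) (t : ⨂[k] _ : Fin l, A), g (∑ i, place k l i a * t) = h a * g t := by
    intro a t
    induction t using PiTensorProduct.induction_on with
    | smul_tprod r b =>
      have := hpsi (Fin.cons a b)
      rw [psi_cons, sub_eq_zero] at this
      simp only [mul_smul_comm, ← Finset.smul_sum, map_smul, place_mul_tprod, map_sum]
      simp only [g, LinearMap.smul_apply, PiTensorProduct.lift.tprod, mul_smul_comm, this,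
        ← Finset.smul_sum]
    | add x y hx hy => simp only [mul_add, Finset.sum_add_distrib, map_add, hx, hy]
  have gsym' : ∀ (a : A) (t : TS k A l), g ↑(sym k l a * t) = h a * g t := by
    intro a t
    rw [← gsym, ← Finset.sum_mul]
    rfl
  have gmul : ∀ s t : TS k A l, g ↑(s * t) = g s * g t := by
    intro s
    have hs : s ∈ Algebra.adjoin k (Set.range (sym k (A := A) l)) := by rw [adjoin_sym]; trivial
    induction hs using Algebra.adjoin_induction with
    | mem x hx =>
      obtain ⟨a, rfl⟩ := hx
      intro t
      have := gsym' a 1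
      rw [mul_one, OneMemClass.coe_one, g1, mul_one] at this
      rw [gsym', this]
    | algebraMap r =>
      intro t
      simp only [Algebra.algebraMap_eq_smul_one, smul_mul_assoc, one_mul]
      simp [g1]
    | add x y _ _ hx hy =>
      intro t
      rw [add_mul, Subalgebra.coe_add, map_add, hx, hy, Subalgebra.coe_add, map_add, add_mul]
    | mul x y _ _ hx hy =>
      intro t
      rw [mul_assoc, hx, hy, hx, mul_assoc]
  refine ⟨AlgHom.ofLinearMap (g ∘ₗ (TS k A l).val.toLinearMap) g1 gmul, fun a => ?_⟩
  have := gsym' a 1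
  rw [mul_one, OneMemClass.coe_one, g1, mul_one] at this
  exact this

end Presentation

end SymTensor

open SymTensor

/-! ### The rank-one computation in the map algebra of 𝔰𝔩₂. -/

section CurrentSl2

/-- The commutation relations of the map algebra `𝔰𝔩₂ ⊗ A`, for linear maps `e f h : A → R` into an
associative algebra. -/
structure IsCurrentSl2 {k A R : Type*} [CommRing k] [CommRing A] [Algebra k A] [Ring R]
    [Algebra k R] (e f h : A →ₗ[k] R) : Prop where
  e_mul_f : ∀ a b, e a * f b = f b * e a + h (a * b)
  h_mul_e : ∀ a b, h a * e b = e b * h a + 2 • e (a * b)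
  h_mul_f : ∀ a b, h a * f b = f b * h a - 2 • f (a * b)
  e_comm : ∀ a b, Commute (e a) (e b)
  h_comm : ∀ a b, Commute (h a) (h b)

section Ofn

variable {k A R : Type*} [CommRing k] [CommRing A] [Algebra k A] [Ring R] [Algebra k R]

/-- The ordered product `g(b₁) ⋯ g(b_n)`. -/
def ordProd (g : A →ₗ[k] R) {n : ℕ} (b : Fin n → A) : R := (List.ofFn fun i => g (b i)).prod

theorem ordProd_cons (g : A →ₗ[k] R) {n : ℕ} (a : A) (b : Fin n → A) :
    ordProd g (Fin.cons a b : Fin (n + 1) → A) = g a * ordProd g b := by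
  simp [ordProd, List.ofFn_succ]

/-- Leibniz rule: the commutator with `x` is a derivation sending each factor `g b` to `z • g (c *
b)`. -/
theorem mul_ordProd (g : A →ₗ[k] R) (z : ℤ) (x : R) (c : A)
    (hx : ∀ b, x * g b = g b * x + z • g (c * b)) {n : ℕ} (b : Fin n → A) :
    x * ordProd g b =
      ordProd g b * x + z • ∑ j, ordProd g (Function.update b j (c * b j)) := by
  induction n with
  | zero => simp [ordProd]
  | succ n ih =>
    rw [← Fin.cons_self_tail b]
    simp only [Fin.sum_univ_succ, Fin.cons_zero, Fin.cons_succ, Fin.update_cons_zero,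
      ← Fin.cons_update, ordProd_cons]
    rw [← mul_assoc, hx, add_mul, mul_assoc, ih, mul_add, smul_add, smul_mul_assoc,
      mul_smul_comm, Finset.mul_sum, mul_assoc]
    abel

end Ofn

variable {k A R M : Type*} [Field k] [CommRing A] [Algebra k A] [Ring R]
  [Algebra k R] [AddCommGroup M] [Module R M] {e f h : A →ₗ[k] R}

/-- Vectors annihilated by all `e(a)`. -/
def IsVacuum (e : A →ₗ[k] R) (v : M) : Prop := ∀ a, e a • v = 0

theorem eq_of_nsmul_eq_nsmul (k R : Type*) {M : Type*} [Field k] [CharZero k] [Ring R] [Algebra k R]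
    [AddCommGroup M] [Module R M] {n : ℕ} (hn : n ≠ 0) {x y : M} (hxy : n • x = n • y) :
    x = y := by
  have hk : algebraMap k R (n : k)⁻¹ * (n : R) = 1 := by
    rw [← map_natCast (algebraMap k R), ← map_mul, inv_mul_cancel₀ (by exact_mod_cast hn), map_one]
  rw [← one_smul R x, ← one_smul R y, ← hk, mul_smul, mul_smul, Nat.cast_smul_eq_nsmul,
    Nat.cast_smul_eq_nsmul, hxy]

namespace IsCurrentSl2

variable (H : IsCurrentSl2 e f h)
include H

theorem h_smul_vacuum {v : M} (hv : IsVacuum e v) (a : A) : IsVacuum e (h a • v) := by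
  intro b
  have : e b * h a = h a * e b - 2 • e (a * b) := by rw [H.h_mul_e]; abel
  rw [smul_smul, this, sub_smul, mul_smul, smul_assoc, hv, hv, smul_zero, smul_zero, sub_zero]

/-- Vacuum vectors are stable under each `h a`, hence under the subalgebra they generate, which
contains the values of Ψ. -/
theorem psi_smul_vacuum {v : M} (hv : IsVacuum e v) (n : ℕ) (b : Fin n → A) :
    IsVacuum e (psi h n b • v) := by
  have : psi h n b ∈ Algebra.adjoin k (Set.range h) :=
    psi_mem _ _ (fun a => Algebra.subset_adjoin (Set.mem_range_self a)) n b
  generalize psi h n b = p at this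
  induction this using Algebra.adjoin_induction generalizing v with
  | mem x hx => obtain ⟨a, rfl⟩ := hx; exact H.h_smul_vacuum hv a
  | algebraMap r =>
    intro a
    rw [smul_smul, ← Algebra.commutes, mul_smul, hv, smul_zero]
  | add x y _ _ hx hy => intro a; rw [add_smul, smul_add, hx hv, hy hv, add_zero]
  | mul x y _ _ hx hy => rw [mul_smul]; exact hx (hy hv)

theorem psi_comm (n : ℕ) (b : Fin n → A) (a : A) : psi h n b * h a = h a * psi h n b := by
  have := psi_mem (Subalgebra.centralizer k {h a}) h (fun c => by
    rw [Subalgebra.mem_centralizer_iff]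
    rintro _ rfl
    exact H.h_comm a c) n b
  exact ((Subalgebra.mem_centralizer_iff k).1 this _ rfl).symm

theorem h_mul_ordProd_f {n : ℕ} (c : A) (b : Fin n → A) :
    h c * ordProd f b =
      ordProd f b * h c - 2 • ∑ j, ordProd f (Function.update b j (c * b j)) := by
  have := mul_ordProd f (-2) (h c) c (fun b => by rw [H.h_mul_f]; module) b
  rw [this]
  module

theorem h_mul_ordProd_e {n : ℕ} (c : A) (b : Fin n → A) :
    h c * ordProd e b =
      ordProd e b * h c + 2 • ∑ j, ordProd e (Function.update b j (c * b j)) := by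
  have := mul_ordProd e 2 (h c) c (fun b => by rw [H.h_mul_e]; module) b
  rw [this]
  module

theorem h_mul_pow (n : ℕ) (a : A) :
    h a * e 1 ^ (n + 1) = e 1 ^ (n + 1) * h a + (2 * (n + 1)) • (e a * e 1 ^ n) := by
  have hc : e 1 ^ (n + 1) * e a = e a * e 1 ^ (n + 1) := ((H.e_comm a 1).pow_right (n + 1)).eq.symm
  induction n with
  | zero => simp [H.h_mul_e]
  | succ n ih =>
    have hc' : e 1 ^ (n + 1) * e a = e a * e 1 ^ (n + 1) :=
      ((H.e_comm a 1).pow_right (n + 1)).eq.symm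
    rw [pow_succ (e 1) (n + 1), ← mul_assoc, ih hc', add_mul, mul_assoc, H.h_mul_e, mul_one,
      mul_add, smul_mul_assoc, mul_assoc (e a), ← pow_succ, mul_smul_comm, hc', mul_assoc]
    module

/-- Moving `f a` to the left leaves the sum of `e(1)^i h(a) e(1)^(n-i)` for 0 ≤ i ≤ n. These terms
form an arithmetic progression with step `-2 e(a) e(1)^(n-1)`, so twice the sum is n + 1 times the
sum of the two extreme terms. -/
theorem two_smul_pow_mul_f (n : ℕ) (a : A) :
    2 • (e 1 ^ (n + 1) * f a) =
      2 • (f a * e 1 ^ (n + 1)) + (n + 1) • (h a * e 1 ^ n + e 1 ^ n * h a) := by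
  induction n with
  | zero =>
    simp only [zero_add, pow_one, H.e_mul_f, pow_zero, mul_one, one_mul]
    module
  | succ n ih =>
    have h1 : e 1 * h a = h a * e 1 - 2 • e a := by rw [H.h_mul_e, mul_one]; module
    have h2 := H.h_mul_pow n a
    have h3 : e 1 ^ (n + 1) * h a = h a * e 1 ^ (n + 1) - (2 * (n + 1)) • (e a * e 1 ^ n) := by
      rw [h2]; module
    rw [pow_succ' (e 1) (n + 1), mul_assoc, ← mul_smul_comm, ih, mul_add, mul_smul_comm,
      mul_smul_comm, ← mul_assoc, H.e_mul_f, mul_add, ← mul_assoc, ← mul_assoc, ← pow_succ',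
      h1, h3, add_mul, mul_assoc, ← pow_succ', one_mul, sub_mul, mul_assoc, ← pow_succ',
      smul_mul_assoc]
    module

variable [CharZero k]

/-- `e(1)ⁿ f(b₁) ⋯ f(b_n)` acts on vacuum vectors as `n! Ψ_n(b₁, …, b_n)`. -/
theorem pow_smul_ordProd_smul (n : ℕ) (b : Fin n → A) {v : M} (hv : IsVacuum e v) :
    e 1 ^ n • ordProd f b • v = n.factorial • psi h n b • v := by
  induction n generalizing v with
  | zero => simp [ordProd]
  | succ n ih =>
    obtain ⟨a, b, rfl⟩ : ∃ a b', b = Fin.cons a b' := ⟨b 0, Fin.tail b, (Fin.cons_self_tail b).symm⟩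
    apply eq_of_nsmul_eq_nsmul k R two_ne_zero
    -- The first n raising operators already produce a vacuum vector, so one more kills it.
    have hz : e 1 ^ (n + 1) • ordProd f b • v = 0 := by
      rw [pow_succ', mul_smul, ih b hv, smul_comm, H.psi_smul_vacuum hv, smul_zero]
    have h1 : h a • e 1 ^ n • ordProd f b • v = n.factorial • (h a * psi h n b) • v := by
      rw [ih b hv, smul_comm, mul_smul]
    have h2 : e 1 ^ n • h a • ordProd f b • v = n.factorial • (h a * psi h n b) • v -
        2 • n.factorial • ∑ j, psi h n (Function.update b j (a * b j)) • v := by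
      rw [smul_smul (h a), H.h_mul_ordProd_f, sub_smul, smul_sub, mul_smul,
        ih b (H.h_smul_vacuum hv a), smul_smul (psi h n b), H.psi_comm, smul_assoc, smul_comm _ 2,
        Finset.sum_smul, Finset.smul_sum, Finset.smul_sum (r := n.factorial)]
      simp only [ih _ hv]
    have h3 := congrArg (· • ordProd f b • v) (H.two_smul_pow_mul_f n a)
    simp only [add_smul _ _ (ordProd f b • v), smul_assoc, mul_smul, hz, h1, h2, smul_zero] at h3
    rw [ordProd_cons, mul_smul (f a), h3, psi_cons, Nat.factorial_succ, sub_smul, Finset.sum_smul,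
      mul_smul (h a)]
    generalize h a • psi h n b • v = x
    generalize ∑ j, psi h n (Function.update b j (a * b j)) • v = y
    module

/-- On vacuum vectors, `e(a₁) ⋯ e(a_l) e(1)^m f(b₁) ⋯ f(b_{l + m})` acts through the span of
the values of `Ψ_{l+m}`. -/
theorem exists_psi_smul (n m l : ℕ) (hn : m + l = n) (a : Fin l → A) (b : Fin n → A) :
    ∃ p ∈ Submodule.span k (Set.range (psi h n)), ∀ v : M, IsVacuum e v →
      ordProd e a • e 1 ^ m • ordProd f b • v = p • v := by
  induction l generalizing m b with
  | zero =>
    obtain rfl : m = n := by omega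
    refine ⟨m.factorial • psi h m b, nsmul_mem (Submodule.subset_span (Set.mem_range_self b)) _,
      fun v hv => ?_⟩
    rw [H.pow_smul_ordProd_smul _ _ hv]
    simp [ordProd, ← smul_assoc]
  | succ l ih =>
    obtain ⟨c, a, rfl⟩ : ∃ c a', a = Fin.cons c a' := ⟨a 0, Fin.tail a, (Fin.cons_self_tail a).symm⟩
    obtain ⟨p, hp, hpv⟩ := ih (m + 1) (by omega) a b
    -- One `e(1)` is traded for `e(c)`: commuting `h(c)` past `e(1)^(m+1)` creates 2(m+1) `e(c)
    -- e(1)^m`. The other commutators hit the `f`-factors, giving `q`, or the remaining `e`-factors,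
    -- giving `r`. The two terms in which `h(c)` survives cancel because `p` commutes with `h(c)`.
    choose q hq hqv using fun j => ih (m + 1) (by omega) a (Function.update b j (c * b j))
    choose r hr hrv using fun j => ih (m + 1) (by omega) (Function.update a j (c * a j)) b
    have hcomm : p * h c = h c * p := by
      have : Submodule.span k (Set.range (psi h n)) ≤
          Subalgebra.toSubmodule (Subalgebra.centralizer k {h c}) := by
        rw [Submodule.span_le]
        rintro _ ⟨b, rfl⟩
        refine (Subalgebra.mem_centralizer_iff k).2 ?_
        rintro _ rfl
        exact (H.psi_comm n b c).symm
      exact ((Subalgebra.mem_centralizer_iff k).1 (this hp) _ rfl).symm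
    have hec : Commute (e c) (ordProd e a) := by
      refine Commute.list_prod_right _ _ fun x hx => ?_
      obtain ⟨j, rfl⟩ := (List.mem_ofFn' _ _).1 hx
      exact H.e_comm _ _
    refine ⟨((m + 1 : ℕ) : k)⁻¹ • (∑ j, q j - ∑ j, r j), Submodule.smul_mem _ _
      (Submodule.sub_mem _ (Submodule.sum_mem _ fun j _ => hq j)
        (Submodule.sum_mem _ fun j _ => hr j)), fun v hv => ?_⟩
    apply eq_of_nsmul_eq_nsmul k R (n := 2 * (m + 1)) (by omega)
    rw [← smul_assoc (2 * (m + 1)) (_ • _) v, mul_smul 2 (m + 1) (_ • _ : R),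
      ← Nat.cast_smul_eq_nsmul k (m + 1), smul_smul _ _ (_ - _ : R),
      mul_inv_cancel₀ (by exact_mod_cast m.succ_ne_zero), one_smul]
    have h1 : h c • ordProd e a • e 1 ^ (m + 1) • ordProd f b • v = (h c * p) • v := by
      rw [hpv v hv, mul_smul]
    have h2 : ordProd e a • e 1 ^ (m + 1) • h c • ordProd f b • v =
        (h c * p) • v - 2 • ∑ j, q j • v := by
      rw [smul_smul (h c), H.h_mul_ordProd_f, sub_smul, smul_sub, smul_sub, mul_smul (ordProd f b),
        hpv _ (H.h_smul_vacuum hv c), smul_smul p, hcomm, smul_assoc, smul_comm _ 2,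
        smul_comm _ 2, Finset.sum_smul, Finset.smul_sum, Finset.smul_sum]
      simp only [hqv _ v hv]
    have h3 : h c • ordProd e a • e 1 ^ (m + 1) • ordProd f b • v =
        ordProd e a • e 1 ^ (m + 1) • h c • ordProd f b • v +
        (2 * (m + 1)) • (e c * ordProd e a) • e 1 ^ m • ordProd f b • v +
        2 • ∑ j, r j • v := by
      rw [smul_smul (h c), H.h_mul_ordProd_e, add_smul, mul_smul, smul_smul (h c), H.h_mul_pow,
        add_smul, smul_add, mul_smul, smul_assoc, smul_comm _ (2 * (m + 1)), hec.eq,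
        mul_smul (ordProd e a), mul_smul (e c), smul_assoc 2,
        Finset.sum_smul]
      simp only [hrv _ v hv]
    rw [h1, h2] at h3
    rw [ordProd_cons, smul_assoc, sub_smul, Finset.sum_smul, Finset.sum_smul]
    generalize (h c * p) • v = x at h3
    generalize (e c * ordProd e a) • e 1 ^ m • ordProd f b • v = y at h3 ⊢
    linear_combination (norm := skip) -h3
    generalize ∑ j, q j • v = y
    generalize ∑ j, r j • v = z
    module

end IsCurrentSl2

end CurrentSl2

namespace Matrix

/-! ### Strictly upper and lower triangular parts of a commutator. -/

section Triangular

variable {R M : Type*} [CommRing R] [Fintype M] [LinearOrder M]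

/-- The strictly upper triangular part of a matrix. -/
def strictUpper (U : Matrix M M R) : Matrix M M R := of fun i j => if i < j then U i j else 0

theorem strictUpper_add (U V : Matrix M M R) :
    strictUpper (U + V) = strictUpper U + strictUpper V := by
  ext i j; simp only [strictUpper, of_apply, add_apply]; split_ifs <;> simp

theorem strictUpper_sub (U V : Matrix M M R) :
    strictUpper (U - V) = strictUpper U - strictUpper V := by
  ext i j; simp only [strictUpper, of_apply, sub_apply]; split_ifs <;> simp

theorem strictUpper_smul (c : R) (U : Matrix M M R) :
    strictUpper (c • U) = c • strictUpper U := by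
  ext i j; simp only [strictUpper, of_apply, smul_apply]; split_ifs <;> simp

theorem strictUpper_apply_of_lt (U : Matrix M M R) {i j : M} (h : i < j) :
    strictUpper U i j = U i j := by
  simp [strictUpper, h]

theorem strictUpper_apply_of_not_lt (U : Matrix M M R) {i j : M} (h : ¬ i < j) :
    strictUpper U i j = 0 := by
  simp [strictUpper, h]

theorem sub_strictUpper_apply_of_lt (U : Matrix M M R) {i j : M} (h : i < j) :
    (U - strictUpper U) i j = 0 := by
  simp [strictUpper, h]

theorem mul_apply_of_strict {U V : Matrix M M R} (hU : ∀ i j, ¬ i < j → U i j = 0)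
    (hV : ∀ i j, j < i → V i j = 0) {i j : M} (h : ¬ i < j) : (U * V) i j = 0 := by
  rw [mul_apply]
  refine Finset.sum_eq_zero fun m _ => ?_
  by_cases him : i < m
  · rw [hV m j (by order), mul_zero]
  · rw [hU _ _ him, zero_mul]

theorem mul_apply_of_strict' {U V : Matrix M M R} (hU : ∀ i j, j < i → U i j = 0)
    (hV : ∀ i j, ¬ i < j → V i j = 0) {i j : M} (h : ¬ i < j) : (U * V) i j = 0 := by
  rw [mul_apply]
  refine Finset.sum_eq_zero fun m _ => ?_
  by_cases him : m < j
  · rw [hU i m (by order), zero_mul]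
  · rw [hV _ _ him, mul_zero]

theorem mul_apply_of_lower {U V : Matrix M M R} (hU : ∀ i j, i < j → U i j = 0)
    (hV : ∀ i j, i < j → V i j = 0) {i j : M} (h : i < j) : (U * V) i j = 0 := by
  rw [mul_apply]
  refine Finset.sum_eq_zero fun m _ => ?_
  by_cases him : i < m
  · rw [hU _ _ him, zero_mul]
  · rw [hV m j (by order), mul_zero]

theorem mul_diag_of_lower {U V : Matrix M M R} (hU : ∀ i j, i < j → U i j = 0)
    (hV : ∀ i j, i < j → V i j = 0) (i : M) : (U * V) i i = U i i * V i i := by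
  rw [mul_apply]
  refine Finset.sum_eq_single i (fun m _ hm => ?_) (by simp)
  rcases lt_or_gt_of_ne hm with h | h
  · rw [hV _ _ h, mul_zero]
  · rw [hU _ _ h, zero_mul]

theorem mul_diag_of_upper {U V : Matrix M M R} (hU : ∀ i j, j < i → U i j = 0)
    (hV : ∀ i j, j < i → V i j = 0) (i : M) : (U * V) i i = U i i * V i i := by
  rw [mul_apply]
  refine Finset.sum_eq_single i (fun m _ hm => ?_) (by simp)
  rcases lt_or_gt_of_ne hm with h | h
  · rw [hU _ _ h, zero_mul]
  · rw [hV _ _ h, mul_zero]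

theorem strictUpper_eq_self {U : Matrix M M R} (hU : ∀ i j, ¬ i < j → U i j = 0) :
    strictUpper U = U := by
  ext i j
  by_cases h : i < j
  · exact strictUpper_apply_of_lt U h
  · rw [strictUpper_apply_of_not_lt U h, hU _ _ h]

theorem strictUpper_mul_strictUpper (U V : Matrix M M R) :
    strictUpper (strictUpper U * strictUpper V) = strictUpper U * strictUpper V :=
  strictUpper_eq_self fun _ _ h => mul_apply_of_strict
    (fun _ _ h => strictUpper_apply_of_not_lt U h)
    (fun _ _ h => strictUpper_apply_of_not_lt V h.not_gt) h

theorem strictUpper_lower_mul_lower (U V : Matrix M M R) :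
    strictUpper ((U - strictUpper U) * (V - strictUpper V)) = 0 := by
  ext i j
  by_cases h : i < j
  · rw [strictUpper_apply_of_lt _ h]
    exact mul_apply_of_lower (fun _ _ h => sub_strictUpper_apply_of_lt U h)
      (fun _ _ h => sub_strictUpper_apply_of_lt V h) h
  · rw [strictUpper_apply_of_not_lt _ h]; rfl

/-- Lower triangular matrices form a Lie subalgebra: expand the vanishing strictly upper part of the
commutator of the two lower parts. This identity makes `BigCell.field` a Lie homomorphism. -/
theorem strictUpper_commutator (U V : Matrix M M R) :
    strictUpper (U * V - V * U) = strictUpper (strictUpper U * V - V * strictUpper U) +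
      strictUpper (U * strictUpper V - strictUpper V * U) -
      (strictUpper U * strictUpper V - strictUpper V * strictUpper U) := by
  have h1 := strictUpper_lower_mul_lower U V
  have h2 := strictUpper_lower_mul_lower V U
  simp only [sub_mul, mul_sub, strictUpper_sub, strictUpper_mul_strictUpper] at h1 h2 ⊢
  linear_combination (norm := abel) h1 - h2

/-- Diagonals multiply entrywise for lower triangular matrices, so their commutator has zero
diagonal; products of strictly upper ones have zero diagonal as well. -/
theorem diag_commutator (U V : Matrix M M R) (i : M) :
    (U * V - V * U) i i = (strictUpper U * V - V * strictUpper U) i i +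
      (U * strictUpper V - strictUpper V * U) i i := by
  have h0 : ∀ U V : Matrix M M R, (strictUpper U * strictUpper V) i i = 0 := fun U V =>
    mul_apply_of_strict (fun _ _ h => strictUpper_apply_of_not_lt U h)
    (fun _ _ h => strictUpper_apply_of_not_lt V h.not_gt) (lt_irrefl i)
  have h1 : ∀ U V : Matrix M M R, ((U - strictUpper U) * (V - strictUpper V)) i i =
      (U - strictUpper U) i i * (V - strictUpper V) i i := fun U V =>
    mul_diag_of_lower (fun _ _ h => sub_strictUpper_apply_of_lt U h)
      (fun _ _ h => sub_strictUpper_apply_of_lt V h) i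
  have h2 : ((U - strictUpper U) * (V - strictUpper V) -
      (V - strictUpper V) * (U - strictUpper U)) i i = 0 := by
    rw [sub_apply, h1, h1, mul_comm, sub_self]
  simp only [sub_mul, mul_sub, sub_apply, h0] at h2 ⊢
  linear_combination h2

theorem map_derivation_mul {S : Type*} [CommRing S] [Algebra S R] (d : Derivation S R R)
    (U V : Matrix M M R) : (U * V).map d = U.map d * V + U * V.map d := by
  ext i j
  simp only [map_apply, mul_apply, map_sum, Derivation.leibniz, add_apply, smul_eq_mul,
    Finset.sum_add_distrib]
  rw [add_comm]
  congr 1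
  exact Finset.sum_congr rfl fun _ _ => mul_comm _ _

theorem map_derivation_inv {S : Type*} [CommRing S] [Algebra S R] (d : Derivation S R R)
    (U : Matrix M M R) (hU : IsUnit U.det) : U⁻¹.map d = - (U⁻¹ * U.map d * U⁻¹) := by
  have h := map_derivation_mul d U U⁻¹
  have h1 : (1 : Matrix M M R).map d = 0 := by
    ext i j
    by_cases hij : i = j
    · subst hij; simp
    · simp [hij]
  rw [mul_nonsing_inv _ hU, h1] at h
  have h2 : U * U⁻¹.map d = - (U.map d * U⁻¹) := by
    rw [eq_neg_iff_add_eq_zero, add_comm]; exact h.symm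
  calc U⁻¹.map d = U⁻¹ * (U * U⁻¹.map d) := by rw [← mul_assoc, nonsing_inv_mul _ hU, one_mul]
    _ = _ := by rw [h2, mul_neg, mul_assoc]

end Triangular

end Matrix

/-! ### A universal highest weight module for the general linear Lie algebra -/

namespace BigCell

open Matrix MvPolynomial

variable (B M : Type*) [CommRing B] [Fintype M] [LinearOrder M]

/-- The generic upper unipotent matrix. -/
def generic : Matrix M M (MvPolynomial (M × M) B) :=
  of fun i j => if i < j then X (i, j) else if i = j then 1 else 0

theorem generic_upper (i j : M) (h : j < i) : generic B M i j = 0 := by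
  simp [generic, h.not_gt, h.ne']

theorem generic_diag (i : M) : generic B M i i = 1 := by
  simp [generic]

theorem isUnit_det_generic : IsUnit (generic B M).det := by
  rw [det_of_isUpperTriangular (M := generic B M) fun i j h => generic_upper B M i j h]
  simp [generic_diag]

theorem inv_generic_upper (i j : M) (h : j < i) : (generic B M)⁻¹ i j = 0 := by
  let := invertibleOfIsUnitDet _ (isUnit_det_generic B M)
  exact blockTriangular_inv_of_blockTriangular (M := generic B M) (b := id)
    (fun i j h => generic_upper B M i j h) h

theorem inv_generic_diag (i : M) : (generic B M)⁻¹ i i = 1 := by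
  have h := mul_diag_of_upper (inv_generic_upper B M) (generic_upper B M) i
  rw [nonsing_inv_mul _ (isUnit_det_generic B M), generic_diag, one_apply_eq, mul_one] at h
  exact h.symm

variable {B M}

/-- The conjugate `n⁻¹ y n` of a constant matrix by the generic upper unipotent matrix. -/
def conj (y : Matrix M M B) : Matrix M M (MvPolynomial (M × M) B) :=
  (generic B M)⁻¹ * y.map C * generic B M

theorem conj_add (y z : Matrix M M B) : conj (y + z) = conj y + conj z := by
  simp [conj, Matrix.map_add, mul_add, add_mul]

theorem conj_smul (c : B) (y : Matrix M M B) :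
    conj (c • y) = (C c : MvPolynomial (M × M) B) • conj y := by
  have : (c • y).map (C : B →+* MvPolynomial (M × M) B) = (C c : MvPolynomial (M × M) B) • y.map C := by
    ext; simp
  simp [conj, this]

theorem conj_commutator (y z : Matrix M M B) :
    conj (y * z - z * y) = conj y * conj z - conj z * conj y := by
  have h : ∀ y z : Matrix M M B, conj (y * z) = conj y * conj z := by
    intro y z
    simp only [conj, Matrix.map_mul]
    simp only [mul_assoc]
    rw [← mul_assoc (generic B M) (generic B M)⁻¹, mul_nonsing_inv _ (isUnit_det_generic B M),
      one_mul]
  rw [← h, ← h, eq_sub_iff_add_eq, ← conj_add]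
  simp

/-- The vector field on upper unipotent matrices attached to a matrix. -/
def field (y : Matrix M M B) : Derivation B (MvPolynomial (M × M) B) (MvPolynomial (M × M) B) :=
  mkDerivation B fun p => - (generic B M * strictUpper (conj y)) p.1 p.2

theorem field_X (y : Matrix M M B) (i j : M) :
    field y (X (i, j)) = - (generic B M * strictUpper (conj y)) i j := by
  simp [field]

/-- Geometrically, `field y` is the motion of `n` by -y on the open cell of the flag variety G/B⁻.
Writing `y n = n (n⁻¹ y n)`, the lower triangular part of `n⁻¹ y n` is absorbed by B⁻ and only the
strictly upper part moves `n`. -/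
theorem map_field_generic (y : Matrix M M B) :
    (generic B M).map (field y) = - (generic B M * strictUpper (conj y)) := by
  ext1 i j
  by_cases h : i < j
  · simp [generic, h, field_X]
  · rw [Matrix.neg_apply, mul_apply_of_strict' (generic_upper B M)
      (fun _ _ h => strictUpper_apply_of_not_lt _ h) h, neg_zero]
    by_cases hij : i = j
    · subst hij; simp [generic]
    · simp [generic, h, hij]

theorem map_field_conj (y z : Matrix M M B) :
    (conj z).map (field y) =
      strictUpper (conj y) * conj z - conj z * strictUpper (conj y) := by
  have h0 : (z.map C).map (field y) = 0 := by ext1 i j; simp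
  rw [conj, map_derivation_mul, map_derivation_mul, h0,
    map_derivation_inv _ _ (isUnit_det_generic B M), map_field_generic]
  have h1 : (generic B M)⁻¹ * (generic B M * strictUpper (conj y)) = strictUpper (conj y) := by
    rw [← mul_assoc, nonsing_inv_mul _ (isUnit_det_generic B M), one_mul]
  simp only [mul_neg, neg_mul, neg_neg, h1, mul_zero, add_zero, mul_assoc]
  rw [sub_eq_add_neg]

theorem strictUpper_map (y z : Matrix M M B) :
    (strictUpper (conj z)).map (field y) = strictUpper ((conj z).map (field y)) := by
  ext1 i j
  by_cases h : i < j <;> simp [strictUpper, h]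

theorem field_field_X (y z : Matrix M M B) (i j : M) :
    field y (field z (X (i, j))) =
      (generic B M * (strictUpper (conj y) * strictUpper (conj z) -
        strictUpper (strictUpper (conj y) * conj z - conj z * strictUpper (conj y)))) i j := by
  rw [field_X, map_neg]
  have := congrFun (congrFun (map_derivation_mul (field y) (generic B M) (strictUpper (conj z))) i) j
  rw [map_apply] at this
  rw [this, map_field_generic, strictUpper_map, map_field_conj, ← Matrix.neg_apply]
  rw [mul_sub, neg_mul, mul_assoc, neg_add, neg_neg]
  exact (sub_eq_add_neg _ _).symm

theorem field_commutator (y z : Matrix M M B) (p : MvPolynomial (M × M) B) :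
    field (y * z - z * y) p = field y (field z p) - field z (field y p) := by
  have : field (y * z - z * y) = ⁅field y, field z⁆ := by
    refine derivation_ext fun ⟨i, j⟩ => ?_
    have hQ : strictUpper (conj y * strictUpper (conj z) - strictUpper (conj z) * conj y) =
        - strictUpper (strictUpper (conj z) * conj y - conj y * strictUpper (conj z)) := by
      rw [strictUpper_sub, strictUpper_sub, neg_sub]
    rw [Derivation.commutator_apply, field_field_X, field_field_X, field_X, conj_commutator,
      strictUpper_commutator, ← Matrix.neg_apply, ← Matrix.sub_apply, ← mul_sub, ← mul_neg, hQ]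
    generalize strictUpper (strictUpper (conj z) * conj y - conj y * strictUpper (conj z)) = Q
    generalize strictUpper (strictUpper (conj y) * conj z - conj z * strictUpper (conj y)) = P
    generalize strictUpper (conj y) * strictUpper (conj z) = S
    generalize strictUpper (conj z) * strictUpper (conj y) = T
    have : -(P + -Q - (S - T)) = S - P - (T - Q) := by abel
    rw [this]
  rw [this, Derivation.commutator_apply]

variable (t : M → B)

/-- The cocycle `y ↦ ∑ t_m (n⁻¹ y n)_{mm}`. -/
def cocycle (y : Matrix M M B) : MvPolynomial (M × M) B := ∑ m, C (t m) * conj y m m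

/-- This is the 1-cocycle condition that keeps `act` a representation after twisting the vector
fields by the weight `t`. -/
theorem cocycle_commutator (y z : Matrix M M B) :
    cocycle t (y * z - z * y) = field y (cocycle t z) - field z (cocycle t y) := by
  have h : ∀ y z, field y (cocycle t z) = ∑ m, C (t m) * ((conj z).map (field y)) m m := by
    intro y z
    simp [cocycle, Derivation.leibniz]
  rw [h, h, ← Finset.sum_sub_distrib]
  refine Finset.sum_congr rfl fun m _ => ?_
  rw [conj_commutator, diag_commutator, map_field_conj, map_field_conj, ← mul_sub]
  simp only [Matrix.sub_apply]
  ring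

/-- Conjugation by an upper unipotent matrix keeps `y` strictly upper triangular. Through `act_one`,
this says that the polynomial 1 is a highest weight vector. -/
theorem cocycle_of_strict {y : Matrix M M B} (hy : ∀ i j, ¬ i < j → y i j = 0) :
    cocycle t y = 0 := by
  refine Finset.sum_eq_zero fun m _ => ?_
  rw [conj, mul_assoc, mul_apply_of_strict' (inv_generic_upper B M) (fun i j h =>
    mul_apply_of_strict (fun i j h => ?_) (generic_upper B M) h) (lt_irrefl m), mul_zero]
  rw [map_apply, hy _ _ h, map_zero]

/-- Conjugation by an upper unipotent matrix does not change the diagonal, so the vector 1 has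
weight `t`, which may be any function `M → B`. -/
theorem cocycle_of_diag {y : Matrix M M B} (hy : ∀ i j, i ≠ j → y i j = 0) :
    cocycle t y = C (∑ m, t m * y m m) := by
  rw [map_sum]
  refine Finset.sum_congr rfl fun m _ => ?_
  have hy' : ∀ i j, j < i → (y.map (C : B →+* MvPolynomial (M × M) B)) i j = 0 := by
    intro i j h
    rw [map_apply, hy _ _ h.ne', map_zero]
  have h2 : ∀ i j, j < i → ((y.map C * generic B M : Matrix M M (MvPolynomial (M × M) B)) i j) = 0 := by
    intro i j h
    rw [mul_apply]
    refine Finset.sum_eq_zero fun m _ => ?_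
    by_cases him : i = m
    · subst him; rw [generic_upper _ _ _ _ h, mul_zero]
    · rw [map_apply, hy _ _ him, map_zero, zero_mul]
  rw [conj, mul_assoc, mul_diag_of_upper (inv_generic_upper B M) h2,
    mul_diag_of_upper hy' (generic_upper B M), generic_diag, inv_generic_diag, one_mul, mul_one,
    map_mul, map_apply]

/-- The first order operator `field y + cocycle y`. -/
def act (y : Matrix M M B) : Module.End B (MvPolynomial (M × M) B) :=
  (field y : MvPolynomial (M × M) B →ₗ[B] MvPolynomial (M × M) B) +
    LinearMap.mulLeft B (cocycle t y)

theorem act_apply (y : Matrix M M B) (p : MvPolynomial (M × M) B) :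
    act t y p = field y p + cocycle t y * p := rfl

theorem act_one (y : Matrix M M B) : act t y 1 = cocycle t y := by
  simp [act_apply]

theorem act_add (y z : Matrix M M B) : act t (y + z) = act t y + act t z := by
  have h1 : field (y + z) = field y + field z := by
    refine derivation_ext fun ⟨i, j⟩ => ?_
    rw [Derivation.add_apply, field_X, field_X, field_X, conj_add, strictUpper_add, mul_add,
      Matrix.add_apply, neg_add]
  have h2 : cocycle t (y + z) = cocycle t y + cocycle t z := by
    simp [cocycle, conj_add, mul_add, Finset.sum_add_distrib]
  refine LinearMap.ext fun p => ?_
  simp only [act_apply, LinearMap.add_apply, h1, h2, Derivation.add_apply]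
  ring

theorem act_smul (c : B) (y : Matrix M M B) : act t (c • y) = c • act t y := by
  have h1 : field (c • y) = c • field y := by
    refine derivation_ext fun ⟨i, j⟩ => ?_
    rw [Derivation.smul_apply, field_X, field_X, conj_smul, strictUpper_smul, mul_smul_comm,
      Matrix.smul_apply, smul_neg, smul_eq_mul, ← smul_eq_C_mul]
  have h2 : cocycle t (c • y) = C c * cocycle t y := by
    simp only [cocycle, conj_smul, Matrix.smul_apply, smul_eq_mul, Finset.mul_sum]
    exact Finset.sum_congr rfl fun _ _ => by ring
  refine LinearMap.ext fun p => ?_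
  simp only [act_apply, LinearMap.smul_apply, h1, h2, Derivation.smul_apply, smul_eq_C_mul]
  ring

theorem act_commutator (y z : Matrix M M B) :
    act t (y * z - z * y) = act t y * act t z - act t z * act t y := by
  refine LinearMap.ext fun p => ?_
  simp only [act_apply, LinearMap.sub_apply, Module.End.mul_apply, field_commutator,
    cocycle_commutator, map_add, Derivation.leibniz, smul_eq_mul]
  ring

end BigCell

namespace UniversalEnvelopingAlgebra

attribute [local instance 100] LieRing.ofAssociativeRing

/-- The universal property gives a homomorphism into `S` whose composite with the inclusion is the
identity. -/
theorem eq_top_of_ι_mem {k L : Type*} [CommRing k] [LieRing L] [LieAlgebra k L]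
    (S : Subalgebra k (UniversalEnvelopingAlgebra k L)) (hS : ∀ x, ι k x ∈ S) : S = ⊤ := by
  let f : L →ₗ⁅k⁆ S :=
    { toFun := fun x => ⟨ι k x, hS x⟩
      map_add' := fun x y => by ext; simp
      map_smul' := fun c x => by ext; simp
      map_lie' := fun {x y} => by
        ext
        simp [LieRing.of_associative_ring_bracket, -ι_apply] }
  have h : S.val.comp (lift k f) = AlgHom.id k _ := by
    apply hom_ext
    ext x
    change ((lift k f (ι k x) : S) : UniversalEnvelopingAlgebra k L) = ι k x
    rw [lift_ι_apply]
    rfl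
  rw [eq_top_iff]
  rintro u -
  have := DFunLike.congr_fun h u
  rw [AlgHom.comp_apply, AlgHom.id_apply] at this
  rw [← this]
  exact (lift k f u).2

theorem ι_mul_ι {k L : Type*} [CommRing k] [LieRing L] [LieAlgebra k L] (x y : L) :
    ι k x * ι k y = ι k y * ι k x + ι k ⁅x, y⁆ := by
  rw [LieHom.map_lie, LieRing.of_associative_ring_bracket]
  abel

end UniversalEnvelopingAlgebra

namespace Seligman

/-! ### Separating `U(L₀)` from the left ideal `U(L) L₊`. -/

section Directness

open UniversalEnvelopingAlgebra

attribute [local instance 100] LieRing.ofAssociativeRing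

variable {k 𝔤 L : Type*} [Field k] [LieRing 𝔤] [LieAlgebra k 𝔤] [LieRing L] [LieAlgebra k L]

theorem envIncl_ι (j : 𝔤 →ₗ⁅k⁆ L) (H : LieSubalgebra k 𝔤) (x : zeroPart j H) :
    envIncl j H (ι k x) = ι k (x : L) := by
  rw [envIncl, lift_ι_apply]
  rfl

/-- A triangular matrix representation of `L` over a commutative algebra separates `U(L₀)` from
`U(L) L₊`: any combination of the diagonal characters kills `U(L₀) ∩ U(L) L₊`. -/
theorem eq_zero_of_envIncl_mem_envPos {B M : Type*} [CommRing B] [Algebra k B] [Fintype M]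
    [LinearOrder M] (j : 𝔤 →ₗ⁅k⁆ L) (H : LieSubalgebra k 𝔤) (Θp : Set (Module.Dual k H))
    (ρ : L →ₗ[k] Matrix M M B) (hρ : ∀ x y, ρ ⁅x, y⁆ = ρ x * ρ y - ρ y * ρ x)
    (hpos : ∀ α ∈ Θp, ∀ x ∈ wtSpace j H α, ∀ m n, ¬ m < n → ρ x m n = 0)
    (hdiag : ∀ x ∈ zeroPart j H, ∀ m n, m ≠ n → ρ x m n = 0)
    (t : M → B) (φ : UniversalEnvelopingAlgebra k (zeroPart j H) →ₐ[k] B)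
    (hφ : ∀ x : zeroPart j H, φ (ι k x) = ∑ m, t m * ρ x m m)
    (u : UniversalEnvelopingAlgebra k (zeroPart j H)) (hu : envIncl j H u ∈ envPos j H Θp) :
    φ u = 0 := by
  let f : L →ₗ⁅k⁆ Module.End B (MvPolynomial (M × M) B) :=
    { toFun := fun x => BigCell.act t (ρ x)
      map_add' := fun x y => by rw [map_add, BigCell.act_add]
      map_smul' := fun c x => by
        rw [map_smul, ← algebraMap_smul B c (ρ x), BigCell.act_smul, algebraMap_smul]
        rfl
      map_lie' := fun {x y} => by
        rw [hρ, BigCell.act_commutator, LieRing.of_associative_ring_bracket] }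
  have hf : ∀ x, f x = BigCell.act t (ρ x) := fun _ => rfl
  -- The vector 1 is annihilated by the left ideal, while `U(L₀)` acts on it by the scalars `φ`; an
  -- element of both therefore has `φ u = 0`.
  have h0 : ∀ v ∈ envPos j H Θp, lift k f v 1 = 0 := by
    intro v hv
    induction hv using Submodule.span_induction with
    | mem v hv =>
      obtain ⟨x, hx, rfl⟩ := hv
      rw [lift_ι_apply, hf, BigCell.act_one]
      refine BigCell.cocycle_of_strict t fun m n hmn => ?_
      have : posPart j H Θp ≤ LinearMap.ker (Matrix.entryLinearMap k B m n ∘ₗ ρ) :=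
        iSup₂_le fun α hα x hx => by simpa using hpos α hα x hx m n hmn
      simpa using this hx
    | zero => simp
    | add v w _ _ hv hw => rw [map_add, LinearMap.add_apply, hv, hw, add_zero]
    | smul r v _ hv => rw [smul_eq_mul, map_mul, Module.End.mul_apply, hv, map_zero]
  have h1 : ∀ w, lift k f (envIncl j H w) 1 = MvPolynomial.C (φ w) := by
    let S : Subalgebra k (UniversalEnvelopingAlgebra k (zeroPart j H)) :=
      { carrier := {w | lift k f (envIncl j H w) 1 = MvPolynomial.C (φ w)}
        mul_mem' := fun {v w} hv hw => by
          simp only [Set.mem_ofPred_eq] at hv hw ⊢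
          rw [map_mul, map_mul, Module.End.mul_apply, hw,
            show (MvPolynomial.C (φ w) : MvPolynomial (M × M) B) = φ w • 1 by
              rw [MvPolynomial.smul_eq_C_mul, mul_one], map_smul, hv, MvPolynomial.smul_eq_C_mul,
              ← map_mul, map_mul φ, mul_comm]
        add_mem' := fun {v w} hv hw => by
          simp only [Set.mem_ofPred_eq] at hv hw ⊢
          rw [map_add, map_add, LinearMap.add_apply, hv, hw, map_add, map_add]
        algebraMap_mem' := fun r => by
          simp only [Set.mem_ofPred_eq]
          rw [AlgHom.commutes, AlgHom.commutes, AlgHom.commutes,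
            Module.algebraMap_end_apply, ← MvPolynomial.algebraMap_eq,
            ← IsScalarTower.algebraMap_apply k B, Algebra.algebraMap_eq_smul_one] }
    have hS : S = ⊤ := eq_top_of_ι_mem S fun x => by
      change lift k f (envIncl j H (ι k x)) 1 = _
      rw [envIncl_ι, lift_ι_apply, hf, BigCell.act_one, BigCell.cocycle_of_diag t (hdiag x x.2), hφ]
    intro w
    have : w ∈ S := by rw [hS]; trivial
    exact this
  exact MvPolynomial.C_injective _ _ (by rw [← h1, h0 _ hu, map_zero])

end Directness

/-! ### Weight spaces of the map algebra and of the adjoint representation. -/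

section WeightSpaces

open LieAlgebra.IsKilling Module

variable {k A 𝔤 : Type*} [Field k] [CommRing A] [Algebra k A] [LieRing 𝔤] [LieAlgebra k 𝔤]
  {H : LieSubalgebra k 𝔤}

/-- `(A ⊗ 𝔤)_α = A ⊗ 𝔤_α`. -/
theorem wtSpace_mapIncl_le (α : Dual k H) :
    wtSpace (mapIncl k A 𝔤) H α ≤
      Submodule.span k {z | ∃ (a : A) (x : 𝔤), (∀ h : H, ⁅(h : 𝔤), x⁆ = α h • x) ∧
        z = a ⊗ₜ[k] x} := by
  classical
  intro z hz
  -- Coordinates along a basis of `A` commute with the action of `H`, so every coefficient in 𝔤 is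
  -- itself a weight vector.
  let e := TensorProduct.equivFinsuppOfBasisLeft (R := k) (N := 𝔤) (Basis.ofVectorSpace k A)
  have he : ∀ (i) (h : H) (y : A ⊗[k] 𝔤), e ⁅mapIncl k A 𝔤 h, y⁆ i = ⁅(h : 𝔤), e y i⁆ := by
    intro i h y
    induction y with
    | zero => simp
    | add x y hx hy => rw [lie_add, map_add, map_add, Finsupp.add_apply, Finsupp.add_apply, hx, hy, lie_add]
    | tmul a x =>
      change e ⁅(1 : A) ⊗ₜ[k] (h : 𝔤), a ⊗ₜ[k] x⁆ i = _
      rw [LieAlgebra.ExtendScalars.bracket_tmul, one_mul]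
      simp [e]
  have hz' : z = (e z).sum fun i x => (Basis.ofVectorSpace k A i) ⊗ₜ[k] x := by
    rw [← TensorProduct.equivFinsuppOfBasisLeft_symm_apply]
    exact (e.symm_apply_apply z).symm
  rw [hz']
  refine Submodule.sum_mem _ fun i _ => Submodule.subset_span ⟨_, _, fun h => ?_, rfl⟩
  rw [← he, hz h, map_smul, Finsupp.smul_apply]

variable [CharZero k] [FiniteDimensional k 𝔤] [LieAlgebra.IsSemisimple k 𝔤]
  [H.IsCartanSubalgebra] [LieModule.IsTriangularizable k H 𝔤]

theorem mem_of_forall_lie_eq_zero {x : 𝔤} (hx : ∀ h : H, ⁅(h : 𝔤), x⁆ = 0) : x ∈ H := by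
  rw [← LieSubalgebra.IsCartanSubalgebra.self_normalizing (H := H),
    LieSubalgebra.mem_normalizer_iff']
  intro y hy
  rw [hx ⟨y, hy⟩]
  exact H.zero_mem

variable (k 𝔤 H) in
theorem exists_weight_basis : ∃ (d : ℕ) (w : Basis (Fin d) k 𝔤) (μ : Fin d → Dual k H),
    (∀ n (h : H), ⁅(h : 𝔤), w n⁆ = μ n h • w n) ∧
    (∀ n, μ n = 0 ∨ μ n ∈ Set.range (rootSystem H).root) ∧
    Submodule.span k (Set.range μ) = ⊤ := by
  classical
  have hint : DirectSum.IsInternal fun χ : LieModule.Weight k H 𝔤 =>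
      (LieModule.genWeightSpace 𝔤 χ).toSubmodule := by
    refine DirectSum.isInternal_submodule_of_iSupIndep_of_iSup_eq_top ?_ ?_
    · exact LieSubmodule.iSupIndep_toSubmodule.2 (LieModule.iSupIndep_genWeightSpace' k H 𝔤)
    · rw [← LieSubmodule.iSup_toSubmodule, LieModule.iSup_genWeightSpace_eq_top' k H 𝔤]
      rfl
  let w := hint.collectedBasis fun χ => Module.finBasis k _
  let e := w.indexEquiv (Module.finBasis k 𝔤)
  refine ⟨_, w.reindex e, fun n => (e.symm n).1.toLinear, fun n h => ?_, fun n => ?_, ?_⟩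
  · rw [Basis.reindex_apply]
    exact lie_eq_smul_of_mem_rootSpace (hint.collectedBasis_mem _ (e.symm n)) h
  · by_cases h0 : (e.symm n).1.IsZero
    · left
      ext h
      simpa using congrFun h0 h
    · right
      exact ⟨⟨(e.symm n).1, by simpa using h0⟩, rfl⟩
  · rw [eq_top_iff, ← span_weight_eq_top (K := k) (H := H) (L := 𝔤)]
    refine Submodule.span_mono ?_
    rintro _ ⟨χ, rfl⟩
    have : Nontrivial (LieModule.genWeightSpace 𝔤 χ).toSubmodule :=
      (Submodule.nontrivial_iff_ne_bot).2 (by simpa using χ.genWeightSpace_ne_bot)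
    have hpos : 0 < Module.finrank k (LieModule.genWeightSpace 𝔤 χ).toSubmodule :=
      Module.finrank_pos
    exact ⟨e ⟨χ, ⟨0, hpos⟩⟩, by simp⟩

end WeightSpaces

end Seligman

namespace Seligman

open LieAlgebra.IsKilling Module UniversalEnvelopingAlgebra

attribute [local instance 100] LieRing.ofAssociativeRing

variable {k A 𝔤 : Type*} [Field k] [CharZero k] [CommRing A] [Algebra k A]
  [LieRing 𝔤] [LieAlgebra k 𝔤] [FiniteDimensional k 𝔤] [LieAlgebra.IsSemisimple k 𝔤]
  {H : LieSubalgebra k 𝔤} [H.IsCartanSubalgebra] [LieModule.IsTriangularizable k H 𝔤]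
  (b : (rootSystem H).Base)

/-! ### Heights, sums of positive roots, and the zero weight space. -/

section Roots

theorem exists_nat_coord_of_mem_closure {β : Dual k H}
    (hβ : β ∈ AddSubmonoid.closure ((rootSystem H).root '' b.support)) (i : b.support) :
    ∃ m : ℕ, b.toWeightBasis.coord i β = m := by
  classical
  induction hβ using AddSubmonoid.closure_induction with
  | mem x hx =>
    obtain ⟨i', hi', rfl⟩ := hx
    refine ⟨if (⟨i', hi'⟩ : b.support) = i then 1 else 0, ?_⟩
    have : (rootSystem H).root i' = b.toWeightBasis ⟨i', hi'⟩ := by simp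
    rw [this, Basis.coord_apply, Basis.repr_self, Finsupp.single_apply]
    split_ifs <;> simp
  | zero => exact ⟨0, by simp⟩
  | add x y _ _ hx hy =>
    obtain ⟨m, hm⟩ := hx
    obtain ⟨n, hn⟩ := hy
    exact ⟨m + n, by rw [map_add, hm, hn, Nat.cast_add]⟩

/-- The linear form on weights which takes the value `1` on the simple roots. -/
def heightForm : Dual k H →ₗ[k] k := ∑ i, b.toWeightBasis.coord i

theorem exists_heightForm_posRoot {β : Dual k H} (hβ : β ∈ posRoots b) :
    ∃ m : ℕ, 0 < m ∧ heightForm b β = m := by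
  choose m hm using exists_nat_coord_of_mem_closure b hβ.2
  refine ⟨∑ i, m i, Nat.pos_of_ne_zero fun h => ?_, by simp [heightForm, hm]⟩
  have h0 : β = 0 := b.toWeightBasis.ext_elem fun i => by
    rw [← Basis.coord_apply, hm, (Finset.sum_eq_zero_iff.1 h) i (Finset.mem_univ i)]
    simp
  obtain ⟨i, hi⟩ := hβ.1
  exact (rootSystem H).ne_zero i (hi.trans h0)

theorem exists_int_heightForm {β : Dual k H} (hβ : β = 0 ∨ β ∈ Set.range (rootSystem H).root) :
    ∃ m : ℤ, heightForm b β = m := by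
  have key : ∀ γ : Dual k H, γ ∈ AddSubmonoid.closure ((rootSystem H).root '' b.support) →
      ∃ m : ℤ, heightForm b γ = m := by
    intro γ hγ
    choose m hm using exists_nat_coord_of_mem_closure b hγ
    exact ⟨∑ i, (m i : ℤ), by simp [heightForm, hm]⟩
  rcases hβ with rfl | ⟨i, rfl⟩
  · exact ⟨0, by simp⟩
  · rcases b.root_mem_or_neg_mem i with h | h
    · exact key _ h
    · obtain ⟨m, hm⟩ := key _ h
      exact ⟨-m, by rw [Int.cast_neg, ← hm, map_neg, neg_neg]⟩

/-- A sum of positive roots which is a multiple of a simple root has all terms equal to it. -/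
theorem eq_simple_of_sum_eq (i : b.support) {m n : ℕ} (β : Fin m → Dual k H)
    (hβ : ∀ q, β q ∈ posRoots b) (hsum : ∑ q, β q = n • (rootSystem H).root i) :
    m = n ∧ ∀ q, β q = (rootSystem H).root i := by
  classical
  have hi : (rootSystem H).root i = b.toWeightBasis i := by simp
  have hall : ∀ q, β q = (rootSystem H).root i := by
    intro q
    choose c hc using fun q i' => exists_nat_coord_of_mem_closure b (hβ q).2 i'
    -- Away from `i` the nonnegative coefficients add up to 0, so each vanishes and `β q` is a
    -- multiple of `α_i`. Reducedness then leaves only `± α_i`, and nonnegativity excludes the minus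
    -- sign.
    have hz : ∀ i', i' ≠ i → c q i' = 0 := by
      intro i' hi'
      have := congrArg (b.toWeightBasis.coord i') hsum
      rw [map_sum, map_nsmul, hi, Basis.coord_apply _ _ (b.toWeightBasis i), Basis.repr_self,
        Finsupp.single_eq_of_ne hi', smul_zero] at this
      simp only [hc] at this
      norm_cast at this
      exact Finset.sum_eq_zero_iff.1 this q (Finset.mem_univ q)
    have hq : β q = (c q i : k) • (rootSystem H).root i := by
      refine b.toWeightBasis.ext_elem fun i' => ?_
      rw [← Basis.coord_apply, hc, hi, map_smul, Basis.repr_self, Finsupp.smul_apply]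
      by_cases h : i' = i
      · subst h; simp
      · rw [hz i' h, Finsupp.single_eq_of_ne h]; simp
    obtain ⟨r, hr⟩ := (hβ q).1
    rw [← hr] at hq
    have hdep : ¬ LinearIndependent k ![(rootSystem H).root r, (rootSystem H).root i] := by
      rw [LinearIndependent.pair_iff]
      intro h
      simpa using h 1 (-(c q i : k)) (by rw [hq]; simp)
    rcases RootPairing.IsReduced.eq_or_eq_neg (P := rootSystem H) r i hdep with h | h
    · rw [← hr, h]
    · exfalso
      have h1 : (c q i : k) = -1 := by
        have h2 := congrArg (b.toWeightBasis.coord i) (h.symm.trans hq)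
        rw [map_neg, map_smul, hi, Basis.coord_apply, Basis.repr_self, Finsupp.single_eq_same] at h2
        simpa using h2.symm
      have h2 : (((c q i) + 1 : ℕ) : k) = 0 := by rw [Nat.cast_add, h1]; simp
      exact (Nat.cast_ne_zero.2 (Nat.succ_ne_zero _)) h2
  refine ⟨?_, hall⟩
  have := congrArg (b.toWeightBasis.coord i) hsum
  simp only [hall] at this
  rw [Finset.sum_const, map_nsmul, map_nsmul, hi, Basis.coord_apply, Basis.repr_self,
    Finsupp.single_eq_same] at this
  simpa using this

variable (A) in
-- The zero weight space of 𝔤 is `H` itself, and the simple coroots form a basis of `H`.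
theorem span_hElem : Submodule.span k (Set.range fun p : b.support × A => hElem (k := k) b p.1 p.2) = ⊤ := by
  rw [eq_top_iff]
  rintro ⟨z, hz⟩ -
  have hz' := wtSpace_mapIncl_le 0 hz
  have hle : Submodule.span k {z : A ⊗[k] 𝔤 | ∃ (a : A) (x : 𝔤),
      (∀ h : H, ⁅(h : 𝔤), x⁆ = (0 : Dual k H) h • x) ∧ z = a ⊗ₜ[k] x} ≤
      (Submodule.span k (Set.range fun p : b.support × A => hElem (k := k) b p.1 p.2)).map
        (zeroPart (mapIncl k A 𝔤) H).toSubmodule.subtype := by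
    rw [Submodule.span_le]
    rintro _ ⟨a, x, hx, rfl⟩
    have hxH : x ∈ H := mem_of_forall_lie_eq_zero (by simpa using hx)
    have hsum := congrArg (H.toSubmodule.subtype) (b.toCoweightBasis.sum_repr ⟨x, hxH⟩)
    rw [map_sum] at hsum
    change _ = x at hsum
    rw [← hsum, TensorProduct.tmul_sum]
    refine Submodule.sum_mem _ fun i _ => ?_
    rw [map_smul, TensorProduct.tmul_smul]
    refine Submodule.smul_mem _ _ ⟨hElem b i a, Submodule.subset_span ⟨(i, a), rfl⟩, ?_⟩
    simp [hElem]
  obtain ⟨y, hy, hyz⟩ := hle hz'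
  have : y = ⟨z, hz⟩ := Subtype.ext hyz
  rwa [← this]

end Roots

/-! ### The adjoint representation evaluated at finitely many points of `A`. -/

section Representation

variable {B Q : Type*} [CommRing B] [Algebra k B] [Fintype Q] [DecidableEq Q] {d : ℕ}

/-- The block diagonal matrix of the operators `ad x` with coefficients `s_q(a)`, `q ∈ Q`. -/
def adMatrix (w : Basis (Fin d) k 𝔤) (s : Q → A →ₐ[k] B) :
    A ⊗[k] 𝔤 →ₗ[k] Matrix (Fin d × Q) (Fin d × Q) B :=
  TensorProduct.lift (LinearMap.mk₂ k (fun a x => Matrix.blockDiagonal fun q =>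
      s q a • (LinearMap.toMatrix w w (LieAlgebra.ad k 𝔤 x)).map (algebraMap k B))
    (fun a a' x => by
      rw [← Matrix.blockDiagonal_add]
      congr 1
      ext1 q
      simp [add_smul])
    (fun c a x => by
      rw [← Matrix.blockDiagonal_smul]
      congr 1
      ext1 q
      simp [smul_assoc])
    (fun a x x' => by
      rw [← Matrix.blockDiagonal_add]
      congr 1
      ext1 q
      ext
      simp [mul_add])
    (fun c a x => by
      rw [← Matrix.blockDiagonal_smul]
      congr 1
      ext1 q
      ext
      simp only [map_smul, Matrix.smul_apply, Matrix.map_apply, smul_eq_mul, map_mul,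
        Pi.smul_apply]
      rw [Algebra.smul_def]
      ring))

theorem adMatrix_tmul (w : Basis (Fin d) k 𝔤) (s : Q → A →ₐ[k] B) (a : A) (x : 𝔤) :
    adMatrix w s (a ⊗ₜ[k] x) = Matrix.blockDiagonal fun q =>
      s q a • (LinearMap.toMatrix w w (LieAlgebra.ad k 𝔤 x)).map (algebraMap k B) := rfl

theorem adMatrix_lie (w : Basis (Fin d) k 𝔤) (s : Q → A →ₐ[k] B) (y z : A ⊗[k] 𝔤) :
    adMatrix w s ⁅y, z⁆ = adMatrix w s y * adMatrix w s z - adMatrix w s z * adMatrix w s y := by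
  induction y with
  | zero => simp
  | add y y' hy hy' =>
    rw [add_lie, map_add, map_add, hy, hy', add_mul, mul_add]
    abel
  | tmul a x =>
    induction z with
    | zero => simp
    | add z z' hz hz' =>
      rw [lie_add, map_add, map_add, hz, hz', add_mul, mul_add]
      abel
    | tmul a' x' =>
      rw [LieAlgebra.ExtendScalars.bracket_tmul, adMatrix_tmul, adMatrix_tmul, adMatrix_tmul,
        ← Matrix.blockDiagonal_mul, ← Matrix.blockDiagonal_mul, ← Matrix.blockDiagonal_sub]
      congr 1
      ext1 q
      have h : LieAlgebra.ad k 𝔤 ⁅x, x'⁆ = LieAlgebra.ad k 𝔤 x * LieAlgebra.ad k 𝔤 x' -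
          LieAlgebra.ad k 𝔤 x' * LieAlgebra.ad k 𝔤 x := by
        rw [LieHom.map_lie]
        rfl
      rw [h, map_sub, LinearMap.toMatrix_mul, LinearMap.toMatrix_mul, Pi.sub_apply]
      simp only [Matrix.smul_mul, Matrix.mul_smul, smul_smul, map_mul]
      rw [mul_comm (s q a') (s q a), ← smul_sub, ← Matrix.map_mul, ← Matrix.map_mul,
        Matrix.map_sub _ (map_sub _)]

variable (w : Basis (Fin d) k 𝔤) (μ : Fin d → Dual k H)
  (hw : ∀ n (h : H), ⁅(h : 𝔤), w n⁆ = μ n h • w n)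
include hw

theorem adMatrix_cartan (s : Q → A →ₐ[k] B) (a : A) (h : H) :
    adMatrix w s (a ⊗ₜ[k] (h : 𝔤)) =
      Matrix.diagonal fun p => s p.2 a * algebraMap k B (μ p.1 h) := by
  rw [adMatrix_tmul, ← Matrix.blockDiagonal_diagonal fun q n => s q a * algebraMap k B (μ n h)]
  congr 1
  ext1 q
  ext n n'
  rw [Matrix.smul_apply, Matrix.map_apply, LinearMap.toMatrix_apply, LieAlgebra.ad_apply, hw,
    map_smul, Basis.repr_self, Finsupp.smul_apply, Finsupp.single_apply, Matrix.diagonal_apply]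
  by_cases hn : n = n'
  · subst hn; simp
  · simp [hn, Ne.symm hn]

/-- An element of weight β shifts weights by β: compare entries in `[h, x] = β(h) x` for an `h`
separating the two weights. -/
theorem adMatrix_eq_zero (s : Q → A →ₐ[k] B) {β : Dual k H} {x : A ⊗[k] 𝔤}
    (hx : x ∈ wtSpace (mapIncl k A 𝔤) H β) {p p' : Fin d × Q} (hp : μ p.1 ≠ μ p'.1 + β) :
    adMatrix w s x p p' = 0 := by
  obtain ⟨h, hh⟩ : ∃ h, μ p.1 h ≠ (μ p'.1 + β) h := by
    by_contra! hc
    exact hp (LinearMap.ext hc)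
  have h1 := congrArg (adMatrix w s) (hx h)
  change adMatrix w s ⁅(1 : A) ⊗ₜ[k] (h : 𝔤), x⁆ = _ at h1
  rw [adMatrix_lie, adMatrix_cartan w μ hw, map_smul] at h1
  have h2 := congrFun (congrFun h1 p) p'
  simp only [map_one, one_mul, Matrix.sub_apply, Matrix.diagonal_mul, Matrix.mul_diagonal,
    Matrix.smul_apply, Algebra.smul_def] at h2
  have h3 : algebraMap k B (μ p.1 h - (μ p'.1 + β) h) * adMatrix w s x p p' = 0 := by
    rw [LinearMap.add_apply, map_sub, map_add]
    linear_combination h2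
  have h4 : IsUnit (algebraMap k B (μ p.1 h - (μ p'.1 + β) h)) :=
    (isUnit_iff_ne_zero.2 (sub_ne_zero.2 hh)).map _
  exact (h4.mul_right_eq_zero).1 h3

end Representation

/-- For the map algebra, `U(L₀) ∩ U(L) L₊` is killed by all characters of `U(L₀)` of the form
`h(a) ↦ ∑_q ω_q(h) s_q(a)`. -/
theorem eq_zero_of_mem_envPos {B Q : Type*} [CommRing B] [Algebra k B] [Fintype Q]
    (s : Q → A →ₐ[k] B) (ω : Q → Dual k H)
    (φ : UniversalEnvelopingAlgebra k (zeroPart (mapIncl k A 𝔤) H) →ₐ[k] B)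
    (hφ : ∀ i a, φ (ι k (hElem b i a)) =
      ∑ q, s q a * algebraMap k B (ω q ((rootSystem H).coroot i)))
    (u : UniversalEnvelopingAlgebra k (zeroPart (mapIncl k A 𝔤) H))
    (hu : envIncl (mapIncl k A 𝔤) H u ∈ envPos (mapIncl k A 𝔤) H (posRoots b)) : φ u = 0 := by
  classical
  obtain ⟨d, w, μ, hw, hμ, hspan⟩ := exists_weight_basis k 𝔤 H
  choose F hF using fun n => exists_int_heightForm b (hμ n)
  -- The weights of the adjoint representation span the dual of `H`. These coefficients become the
  -- diagonal parameters `t` that realise the prescribed `ω q`.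
  have hω : ∀ q, ∃ c : Fin d → k, ∑ n, c n • μ n = ω q := fun q =>
    (Submodule.mem_span_range_iff_exists_fun k).1 (by rw [hspan]; trivial)
  choose c hc using hω
  -- Indices are ordered by decreasing height, with arbitrary tie-breaking, so that positive root
  -- vectors become strictly upper triangular.
  let key : Fin d × Q → ℤ ×ₗ Fin (Fintype.card (Fin d × Q)) :=
    fun p => toLex (-F p.1, Fintype.equivFin _ p)
  have hkey : Function.Injective key := fun p p' h =>
    (Fintype.equivFin _).injective (congrArg Prod.snd (toLex.injective h))
  let := LinearOrder.lift' key hkey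
  have hdiag0 : ∀ i a, adMatrix w s (hElem (k := k) b i a : A ⊗[k] 𝔤) =
      Matrix.diagonal fun p => s p.2 a * algebraMap k B (μ p.1 ((rootSystem H).coroot i)) :=
    fun i a => adMatrix_cartan w μ hw s a _
  refine eq_zero_of_envIncl_mem_envPos (M := Fin d × Q) (mapIncl k A 𝔤) H (posRoots b)
    (adMatrix w s) (adMatrix_lie w s) ?_ ?_ (fun p => algebraMap k B (c p.2 p.1)) φ ?_ u hu
  · intro β hβ x hx p p' hpp'
    refine adMatrix_eq_zero w μ hw s hx fun h => hpp' ?_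
    obtain ⟨m, hm0, hm⟩ := exists_heightForm_posRoot b hβ
    have h1 : F p.1 = F p'.1 + m := by
      have := congrArg (heightForm b) h
      rw [map_add, hF, hF, hm] at this
      exact_mod_cast this
    change key p < key p'
    rw [Prod.Lex.toLex_lt_toLex]
    left
    change -F p.1 < -F p'.1
    omega
  · intro x hx p p' hpp'
    have : (⊤ : Submodule k (zeroPart (mapIncl k A 𝔤) H)) ≤
        LinearMap.ker (Matrix.entryLinearMap k B p p' ∘ₗ adMatrix w s ∘ₗ
          (zeroPart (mapIncl k A 𝔤) H).toSubmodule.subtype) := by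
      rw [← span_hElem A b, Submodule.span_le]
      rintro _ ⟨⟨i, a⟩, rfl⟩
      change adMatrix w s (hElem (k := k) b i a : A ⊗[k] 𝔤) p p' = 0
      rw [hdiag0, Matrix.diagonal_apply_ne _ hpp']
    exact this (x := ⟨x, hx⟩) trivial
  · intro x
    have : φ.toLinearMap ∘ₗ (ι k : zeroPart (mapIncl k A 𝔤) H →ₗ⁅k⁆ _).toLinearMap =
      ∑ p : Fin d × Q, algebraMap k B (c p.2 p.1) •
        (Matrix.entryLinearMap k B p p ∘ₗ adMatrix w s ∘ₗ
          (zeroPart (mapIncl k A 𝔤) H).toSubmodule.subtype) := by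
      refine LinearMap.ext_on (span_hElem A b) ?_
      rintro _ ⟨⟨i, a⟩, rfl⟩
      change φ (ι k (hElem b i a)) = _
      rw [hφ, LinearMap.sum_apply, Fintype.sum_prod_type_right]
      refine Finset.sum_congr rfl fun q _ => ?_
      rw [← hc, LinearMap.sum_apply, map_sum, Finset.mul_sum]
      refine Finset.sum_congr rfl fun n _ => ?_
      change _ = algebraMap k B (c q n) * adMatrix w s (hElem (k := k) b i a : A ⊗[k] 𝔤) (n, q) (n, q)
      rw [hdiag0, Matrix.diagonal_apply_eq, LinearMap.smul_apply, smul_eq_mul, map_mul]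
      ring
    have := DFunLike.congr_fun this x
    rw [LinearMap.sum_apply] at this
    exact this

end Seligman

/-! ### Homomorphisms into and between finite tensor products of algebras. -/

namespace PiTensorProduct

variable {k I : Type*} [Field k] [Finite I] {T T' : I → Type*} [∀ i, Ring (T i)]
  [∀ i, Algebra k (T i)] [∀ i, Ring (T' i)] [∀ i, Algebra k (T' i)]

/-- The tensor product of a family of homomorphisms of algebras. -/
def mapAlg (f : ∀ i, T i →ₐ[k] T' i) : (⨂[k] i, T i) →ₐ[k] ⨂[k] i, T' i :=
  liftAlgHom ((tprod k).compLinearMap fun i => (f i).toLinearMap)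
    (by simp [one_def, Pi.one_def]) (fun x y => by simp [tprod_mul_tprod, Pi.mul_def])

theorem mapAlg_tprod (f : ∀ i, T i →ₐ[k] T' i) (t : ∀ i, T i) :
    mapAlg f (tprod k t) = tprod k fun i => f i (t i) := by
  simp [mapAlg]

theorem mapAlg_single [DecidableEq I] (f : ∀ i, T i →ₐ[k] T' i) (i : I) (t : T i) :
    mapAlg f (singleAlgHom (R := k) i t) = singleAlgHom (R := k) i (f i t) := by
  rw [singleAlgHom_apply, mapAlg_tprod, singleAlgHom_apply]
  congr 1
  ext i'
  by_cases h : i' = i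
  · subst h; simp
  · simp [h]

/-- Over a field each `f i` has a left inverse, only linear in general, and linear maps can be
tensored too. -/
theorem mapAlg_injective (f : ∀ i, T i →ₐ[k] T' i) (hf : ∀ i, Function.Injective (f i)) :
    Function.Injective (mapAlg f) := by
  choose g hg using fun i => (f i).toLinearMap.exists_leftInverse_of_injective
    (LinearMap.ker_eq_bot.2 (hf i))
  have h1 : (mapAlg f).toLinearMap = map fun i => (f i).toLinearMap := by
    ext t
    simp [mapAlg_tprod]
  have h2 : map g ∘ₗ (mapAlg f).toLinearMap = LinearMap.id := by
    rw [h1, ← map_comp]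
    simp only [hg]
    exact map_id
  exact Function.LeftInverse.injective (g := map g) fun x => DFunLike.congr_fun h2 x

theorem exists_algHom_of_comm [Fintype I] [DecidableEq I] {C : Type*} [CommRing C] [Algebra k C]
    (χ : ∀ i, T i →ₐ[k] C) :
    ∃ Ψ : (⨂[k] i, T i) →ₐ[k] C, ∀ i t, Ψ (singleAlgHom (R := k) i t) = χ i t := by
  let F : MultilinearMap k T C :=
    (MultilinearMap.mkPiAlgebra k I C).compLinearMap fun i => (χ i).toLinearMap
  have hF : ∀ t, F t = ∏ i, χ i (t i) := fun t => by simp [F]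
  refine ⟨liftAlgHom F (by simp [hF]) (by simp [hF, Finset.prod_mul_distrib]), fun i t => ?_⟩
  change lift F (tprod k (Pi.mulSingle i t)) = _
  rw [lift.tprod, hF, Finset.prod_eq_single i]
  · simp
  · intro i' _ h
    simp [h]
  · simp

/-- Homomorphisms `T_i → C` with `C` commutative assemble to a homomorphism `⨂ T_i → C`. -/
theorem exists_algHom [Fintype I] [DecidableEq I] {C : Type*} [Ring C] [Algebra k C]
    (hC : ∀ x y : C, x * y = y * x) (χ : ∀ i, T i →ₐ[k] C) :
    ∃ Ψ : (⨂[k] i, T i) →ₐ[k] C, ∀ i t, Ψ (singleAlgHom (R := k) i t) = χ i t := by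
  let _ : CommRing C := { ‹Ring C› with mul_comm := hC }
  exact exists_algHom_of_comm χ

end PiTensorProduct

namespace Seligman

open LieAlgebra.IsKilling Module UniversalEnvelopingAlgebra SymTensor

attribute [local instance 100] LieRing.ofAssociativeRing

/-! ### Harish-Chandra images, and relations in the Seligman algebra. -/

section Harish

variable {k A 𝔤 : Type*} [Field k] [CharZero k] [CommRing A] [Algebra k A]
  [LieRing 𝔤] [LieAlgebra k 𝔤] [FiniteDimensional k 𝔤] [LieAlgebra.IsSemisimple k 𝔤]
  {H : LieSubalgebra k 𝔤} [H.IsCartanSubalgebra] [LieModule.IsTriangularizable k H 𝔤]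
  (b : (rootSystem H).Base)

theorem tmul_mem_wtSpace {α : Dual k H} {x : 𝔤} (hx : ∀ h : H, ⁅(h : 𝔤), x⁆ = α h • x) (a : A) :
    a ⊗ₜ[k] x ∈ wtSpace (mapIncl k A 𝔤) H α := by
  intro h
  change ⁅(1 : A) ⊗ₜ[k] (h : 𝔤), a ⊗ₜ[k] x⁆ = _
  rw [LieAlgebra.ExtendScalars.bracket_tmul, hx, one_mul, TensorProduct.tmul_smul]

/-- Root spaces of 𝔤 are one-dimensional, so `A ⊗ 𝔤_α` consists of pure tensors with a fixed root
vector. -/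
theorem exists_eq_tmul {α : LieModule.Weight k H 𝔤} (hα : α.IsNonZero) {x : 𝔤}
    (hx : x ∈ LieAlgebra.rootSpace H α) (hx0 : x ≠ 0) {z : A ⊗[k] 𝔤}
    (hz : z ∈ wtSpace (mapIncl k A 𝔤) H α.toLinear) : ∃ a : A, z = a ⊗ₜ[k] x := by
  have hle : Submodule.span k {z : A ⊗[k] 𝔤 | ∃ (a : A) (x : 𝔤),
      (∀ h : H, ⁅(h : 𝔤), x⁆ = LieModule.Weight.toLinear k H 𝔤 α h • x) ∧ z = a ⊗ₜ[k] x} ≤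
      LinearMap.range ((TensorProduct.mk k A 𝔤).flip x) := by
    rw [Submodule.span_le]
    rintro _ ⟨a, y, hy, rfl⟩
    have hy' : y ∈ LieAlgebra.rootSpace H α :=
      LieModule.weightSpace_le_genWeightSpace 𝔤 _ ((LieModule.mem_weightSpace _ y).2 hy)
    obtain ⟨c, hc⟩ := (finrank_eq_one_iff_of_nonzero' (⟨x, hx⟩ : LieAlgebra.rootSpace H α)
      (by simpa using hx0)).1 (finrank_rootSpace_eq_one α hα) ⟨y, hy'⟩
    have hc' : c • x = y := congrArg Subtype.val hc
    exact ⟨c • a, by simp [← hc']⟩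
  obtain ⟨a, ha⟩ := hle (wtSpace_mapIncl_le _ hz)
  exact ⟨a, ha.symm⟩

/-- The map `a ↦ a ⊗ x` into the enveloping algebra of the map algebra. -/
def current (k A : Type*) {𝔤 : Type*} [Field k] [CommRing A] [Algebra k A] [LieRing 𝔤]
    [LieAlgebra k 𝔤] (x : 𝔤) : A →ₗ[k] UniversalEnvelopingAlgebra k (A ⊗[k] 𝔤) :=
  (ι k : A ⊗[k] 𝔤 →ₗ⁅k⁆ _).toLinearMap ∘ₗ (TensorProduct.mk k A 𝔤).flip x

theorem current_apply (x : 𝔤) (a : A) : current k A x a = ι k (a ⊗ₜ[k] x) := rfl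

theorem current_mul_current (x y : 𝔤) (a a' : A) : current k A x a * current k A y a' =
    current k A y a' * current k A x a + current k A ⁅x, y⁆ (a * a') := by
  rw [current_apply, current_apply, ι_mul_ι, LieAlgebra.ExtendScalars.bracket_tmul]
  rfl

theorem isCurrentSl2 {h e f : 𝔤} (t : IsSl2Triple h e f) :
    IsCurrentSl2 (current k A e) (current k A f) (current k A h) where
  e_mul_f a a' := by rw [current_mul_current, t.lie_e_f]
  h_mul_e a a' := by
    rw [current_mul_current, t.lie_h_e_nsmul]
    simp only [current_apply, TensorProduct.tmul_smul, map_nsmul]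
  h_mul_f a a' := by
    rw [current_mul_current, t.lie_h_f_nsmul]
    simp only [current_apply, TensorProduct.tmul_smul, TensorProduct.tmul_neg, map_nsmul, map_neg]
    rw [sub_eq_add_neg]
  e_comm a a' := by
    rw [Commute, SemiconjBy, current_mul_current, lie_self]
    simp [current_apply, -ι_apply]
  h_comm a a' := by
    rw [Commute, SemiconjBy, current_mul_current, lie_self]
    simp [current_apply, -ι_apply]

/-- The map `a ↦ h_i(a)` into `U(L₀)`. -/
def hCurrent (i : b.support) : A →ₗ[k] UniversalEnvelopingAlgebra k (zeroPart (mapIncl k A 𝔤) H) where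
  toFun a := ι k (hElem b i a)
  map_add' a a' := by
    rw [← map_add]
    congr 1
    exact Subtype.ext (TensorProduct.add_tmul _ _ _)
  map_smul' c a := by
    rw [RingHom.id_apply, ← map_smul]
    congr 1

theorem envIncl_comp_hCurrent (i : b.support) :
    (envIncl (mapIncl k A 𝔤) H).toLinearMap ∘ₗ hCurrent b i =
      current k A (((rootSystem H).coroot i : H) : 𝔤) := by
  ext a
  exact envIncl_ι _ _ _

theorem root_mem_posRoots (i : b.support) : (rootSystem H).root i ∈ posRoots b :=
  ⟨⟨i, rfl⟩, AddSubmonoid.subset_closure ⟨i, i.2, rfl⟩⟩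

/-- An `𝔰𝔩₂`-triple attached to a simple root. -/
theorem exists_simple_triple (i : b.support) : ∃ e f : 𝔤,
    IsSl2Triple (((rootSystem H).coroot i : H) : 𝔤) e f ∧
    (∀ h : H, ⁅(h : 𝔤), e⁆ = (rootSystem H).root i h • e) ∧
    (∀ h : H, ⁅(h : 𝔤), f⁆ = (-(rootSystem H).root i) h • f) ∧
    (∀ z : A ⊗[k] 𝔤, z ∈ wtSpace (mapIncl k A 𝔤) H ((rootSystem H).root i) →
      ∃ a : A, z = a ⊗ₜ[k] e) ∧
    (∀ z : A ⊗[k] 𝔤, z ∈ wtSpace (mapIncl k A 𝔤) H (-(rootSystem H).root i) →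
      ∃ a : A, z = a ⊗ₜ[k] f) := by
  have hα : (i : H.root).1.IsNonZero := (Finset.mem_filter.1 (i : H.root).2).2
  obtain ⟨h, e, f, t, he, hf⟩ := exists_isSl2Triple_of_weight_isNonZero hα
  obtain rfl := t.h_eq_coroot hα he hf
  refine ⟨e, f, t, fun h => lie_eq_smul_of_mem_rootSpace he h,
    fun h => lie_eq_smul_of_mem_rootSpace hf h, fun z hz => exists_eq_tmul hα he t.e_ne_zero hz,
    fun z hz => ?_⟩
  exact exists_eq_tmul (α := -(i : H.root).1) hα.neg hf t.f_ne_zero hz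

section Triple

variable (i : b.support) {e f : 𝔤} (t : IsSl2Triple (((rootSystem H).coroot i : H) : 𝔤) e f)
  (he : ∀ h : H, ⁅(h : 𝔤), e⁆ = (rootSystem H).root i h • e)
include t he

theorem isVacuum_mk_one : IsVacuum (current k A e)
    (Submodule.Quotient.mk 1 : UniversalEnvelopingAlgebra k (A ⊗[k] 𝔤) ⧸ envPos (mapIncl k A 𝔤) H (posRoots b)) := by
  intro a
  rw [← Submodule.Quotient.mk_smul, smul_eq_mul, mul_one, Submodule.Quotient.mk_eq_zero]
  have hmem : a ⊗ₜ[k] e ∈ posPart (mapIncl k A 𝔤) H (posRoots b) :=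
    Submodule.mem_iSup_of_mem _
      (Submodule.mem_iSup_of_mem (root_mem_posRoots b i) (tmul_mem_wtSpace he a))
  exact Submodule.subset_span ⟨_, hmem, rfl⟩

/-- The class of 1 in `U(L) / U(L) L₊` is a vacuum vector, so the rank-one computation applies to
it; the values of Ψ come from `U(L₀)` by naturality. -/
theorem exists_psi_congr {n : ℕ} (a c : Fin n → A) :
    ∃ p ∈ Submodule.span k (Set.range (psi (hCurrent b i) n)),
      ordProd (current k A e) a * ordProd (current k A f) c - envIncl (mapIncl k A 𝔤) H p ∈
        envPos (mapIncl k A 𝔤) H (posRoots b) := by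
  obtain ⟨p, hp, hpv⟩ := (isCurrentSl2 (k := k) (A := A) t).exists_psi_smul
    (M := UniversalEnvelopingAlgebra k (A ⊗[k] 𝔤) ⧸ envPos (mapIncl k A 𝔤) H (posRoots b))
    n 0 n (by omega) a c
  have hle : Submodule.span k (Set.range (psi (current k A
      (((rootSystem H).coroot i : H) : 𝔤)) n)) ≤
      (Submodule.span k (Set.range (psi (hCurrent b i) n))).map
        (envIncl (mapIncl k A 𝔤) H).toLinearMap := by
    rw [Submodule.span_le]
    rintro _ ⟨c, rfl⟩
    refine ⟨psi (hCurrent b i) n c, Submodule.subset_span (Set.mem_range_self c), ?_⟩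
    rw [AlgHom.toLinearMap_apply, psi_map, envIncl_comp_hCurrent]
  obtain ⟨p, hp', rfl⟩ := hle hp
  refine ⟨p, hp', ?_⟩
  have := hpv _ (isVacuum_mk_one b i t he)
  rw [pow_zero, one_smul, smul_smul, ← Submodule.Quotient.mk_smul, ← Submodule.Quotient.mk_smul,
    smul_eq_mul, smul_eq_mul, mul_one, mul_one] at this
  exact (Submodule.Quotient.eq _).1 this

theorem pow_mul_ordProd_congr {n : ℕ} (c : Fin n → A) :
    current k A e 1 ^ n * ordProd (current k A f) c -
      envIncl (mapIncl k A 𝔤) H (n.factorial • psi (hCurrent b i) n c) ∈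
        envPos (mapIncl k A 𝔤) H (posRoots b) := by
  have := (isCurrentSl2 (k := k) (A := A) t).pow_smul_ordProd_smul n c (isVacuum_mk_one b i t he)
  rw [smul_smul, ← smul_assoc, ← Submodule.Quotient.mk_smul, ← Submodule.Quotient.mk_smul,
    smul_eq_mul, smul_eq_mul, mul_one, mul_one] at this
  rw [map_nsmul, psi_map, envIncl_comp_hCurrent]
  exact (Submodule.Quotient.eq _).1 this

end Triple

theorem mul_ordProd_of_weight {k A R : Type*} [CommRing k] [CommRing A] [Algebra k A] [Ring R]
    [Algebra k R] (g : A →ₗ[k] R) (c : k) (x : R) (hx : ∀ a, x * g a = g a * x + c • g a) {n : ℕ}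
    (a : Fin n → A) : x * ordProd g a = ordProd g a * x + (n * c) • ordProd g a := by
  induction n with
  | zero => simp [ordProd]
  | succ n ih =>
    rw [← Fin.cons_self_tail a, ordProd_cons, ← mul_assoc, hx, add_mul, mul_assoc, ih, mul_add,
      ← mul_assoc, mul_smul_comm, smul_mul_assoc, add_assoc, ← add_smul, Nat.cast_succ,
      add_mul, one_mul]

theorem ι_mul_current {α : Dual k H} {x : 𝔤} (hx : ∀ h : H, ⁅(h : 𝔤), x⁆ = α h • x) (h : H)
    (a : A) : ι k (mapIncl k A 𝔤 h) * current k A x a =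
      current k A x a * ι k (mapIncl k A 𝔤 h) + α h • current k A x a := by
  rw [current_apply, ι_mul_ι, tmul_mem_wtSpace hx a h, map_smul]

theorem mul_mem_envZero {α : Dual k H} {e f : 𝔤} (he : ∀ h : H, ⁅(h : 𝔤), e⁆ = α h • e)
    (hf : ∀ h : H, ⁅(h : 𝔤), f⁆ = (-α) h • f) {n : ℕ} (a c : Fin n → A) :
    ordProd (current k A e) a * ordProd (current k A f) c ∈ envZero (mapIncl k A 𝔤) H := by
  refine (Subalgebra.mem_centralizer_iff k).2 ?_
  rintro _ ⟨h, rfl⟩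
  rw [← mul_assoc, mul_ordProd_of_weight _ _ _ (ι_mul_current he h), add_mul, mul_assoc,
    mul_ordProd_of_weight _ _ _ (ι_mul_current hf h), mul_add, ← mul_assoc, mul_smul_comm,
    smul_mul_assoc, add_assoc, ← add_smul]
  simp

theorem envIncl_mem_envZero (u : UniversalEnvelopingAlgebra k (zeroPart (mapIncl k A 𝔤) H)) :
    envIncl (mapIncl k A 𝔤) H u ∈ envZero (mapIncl k A 𝔤) H := by
  have : (envZero (mapIncl k A 𝔤) H).comap (envIncl (mapIncl k A 𝔤) H) = ⊤ := by
    refine eq_top_of_ι_mem _ fun x => ?_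
    rw [Subalgebra.mem_comap, envIncl_ι]
    refine (Subalgebra.mem_centralizer_iff k).2 ?_
    rintro _ ⟨h, rfl⟩
    rw [ι_mul_ι, x.2 h]
    simp
  have hu : u ∈ (envZero (mapIncl k A 𝔤) H).comap (envIncl (mapIncl k A 𝔤) H) := by
    rw [this]; trivial
  exact hu

/-- The relation `Ψ_{ℓ+1} = 0` holds in the Seligman algebra. -/
theorem can_psi_eq_zero (lam : Dual k H) (i : b.support) (l : ℕ)
    (hl : lam ((rootSystem H).coroot i) = l) (c : Fin (l + 1) → A) :
    can b (mapIncl k A 𝔤) (posRoots b) lam (psi (hCurrent b i) (l + 1) c) = 0 := by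
  obtain ⟨e, f, t, he, hf, -, -⟩ := exists_simple_triple (A := A) b i
  have hpow : ordProd (current k A e) (fun _ : Fin (l + 1) => (1 : A)) =
      current k A e 1 ^ (l + 1) := by simp [ordProd, pow_succ']
  have hgen : IsGenerator b (mapIncl k A 𝔤) (posRoots b) lam
      ((l + 1).factorial • psi (hCurrent b i) (l + 1) c) := by
    -- Taking every `x_q` equal to `1 ⊗ e` suffices: the generator obtained is (l+1)! Ψ_{l+1}, and
    -- the factorial is invertible.
    have hz := mul_mem_envZero (k := k) he hf (fun _ => (1 : A)) c
    refine IsGenerator.hc i l hl (l + 1) (fun _ => (rootSystem H).root i)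
      (fun _ => (1 : A) ⊗ₜ[k] e) (fun q => c q ⊗ₜ[k] f) (fun _ => root_mem_posRoots b i)
      (fun _ => tmul_mem_wtSpace he _) (fun _ => tmul_mem_wtSpace hf _) (by simp) _ ⟨hz, ?_, ?_⟩
    · have := pow_mul_ordProd_congr b i t he c
      rw [← hpow] at this
      exact this
    · exact Subalgebra.sub_mem _ hz (envIncl_mem_envZero _)
  have h0 : can b (mapIncl k A 𝔤) (posRoots b) lam
      ((l + 1).factorial • psi (hCurrent b i) (l + 1) c) = 0 :=
    (RingCon.eq _).2 ((TwoSidedIdeal.mem_iff _ _).1 (TwoSidedIdeal.subset_span hgen))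
  rw [map_nsmul] at h0
  exact eq_of_nsmul_eq_nsmul k (Alg b (mapIncl k A 𝔤) (posRoots b) lam)
    (l + 1).factorial_ne_zero (by rw [h0, smul_zero])

theorem can_hCurrent_one (lam : Dual k H) (i : b.support) (l : ℕ)
    (hl : lam ((rootSystem H).coroot i) = l) :
    can b (mapIncl k A 𝔤) (posRoots b) lam (hCurrent b i 1) = l := by
  have h0 : can b (mapIncl k A 𝔤) (posRoots b) lam (hCurrent b i 1 -
      algebraMap k _ (lam ((rootSystem H).coroot i))) = 0 :=
    (RingCon.eq _).2 ((TwoSidedIdeal.mem_iff _ _).1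
      (TwoSidedIdeal.subset_span (IsGenerator.wt i)))
  rw [map_sub, AlgHom.commutes, sub_eq_zero, hl, map_natCast] at h0
  exact h0

theorem lie_zeroPart (b : (rootSystem H).Base) (x y : zeroPart (mapIncl k A 𝔤) H) : ⁅x, y⁆ = 0 := by
  have hx : x ∈ Submodule.span k (Set.range fun p : b.support × A => hElem (k := k) b p.1 p.2) := by
    rw [span_hElem]; trivial
  have hy : y ∈ Submodule.span k (Set.range fun p : b.support × A => hElem (k := k) b p.1 p.2) := by
    rw [span_hElem]; trivial
  induction hx using Submodule.span_induction with
  | mem x hx =>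
    obtain ⟨⟨i, a⟩, rfl⟩ := hx
    induction hy using Submodule.span_induction with
    | mem y hy =>
      obtain ⟨⟨i', a'⟩, rfl⟩ := hy
      have h0 : ⁅(((rootSystem H).coroot i : H) : 𝔤), (((rootSystem H).coroot i' : H) : 𝔤)⁆ = 0 := by
        simpa using congrArg Subtype.val
          (trivial_lie_zero H H ((rootSystem H).coroot i) ((rootSystem H).coroot i'))
      apply Subtype.ext
      change ⁅a ⊗ₜ[k] (((rootSystem H).coroot i : H) : 𝔤),
        a' ⊗ₜ[k] (((rootSystem H).coroot i' : H) : 𝔤)⁆ = 0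
      rw [LieAlgebra.ExtendScalars.bracket_tmul, h0, TensorProduct.tmul_zero]
    | zero => simp
    | add y z _ _ hy hz => rw [lie_add, hy, hz, add_zero]
    | smul c y _ hy => rw [lie_smul, hy, smul_zero]
  | zero => simp
  | add x z _ _ hx hz => rw [add_lie, hx, hz, add_zero]
  | smul c x _ hx => rw [smul_lie, hx, smul_zero]

theorem mul_comm_env (b : (rootSystem H).Base)
    (u v : UniversalEnvelopingAlgebra k (zeroPart (mapIncl k A 𝔤) H)) :
    u * v = v * u := by
  have h1 : ∀ x : zeroPart (mapIncl k A 𝔤) H, Subalgebra.centralizer k {ι k x} = ⊤ := fun x =>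
    eq_top_of_ι_mem _ fun y => (Subalgebra.mem_centralizer_iff k).2 (by
      rintro _ rfl
      rw [ι_mul_ι, lie_zeroPart b, map_zero, add_zero])
  have h2 : Subalgebra.centralizer k {u} = ⊤ := eq_top_of_ι_mem _ fun x => by
    refine (Subalgebra.mem_centralizer_iff k).2 fun w hw => ?_
    rw [Set.mem_singleton_iff.1 hw]
    have : u ∈ Subalgebra.centralizer k {ι k x} := by rw [h1]; trivial
    exact ((Subalgebra.mem_centralizer_iff k).1 this _ rfl).symm
  have : v ∈ Subalgebra.centralizer k {u} := by rw [h2]; trivial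
  exact (Subalgebra.mem_centralizer_iff k).1 this _ rfl

/-- Homomorphisms from `U(L₀)` to a commutative algebra can be prescribed on the `h_i(a)`. -/
theorem exists_envZero_algHom {C : Type*} [CommRing C] [Algebra k C]
    (g : b.support → A →ₗ[k] C) :
    ∃ φ : UniversalEnvelopingAlgebra k (zeroPart (mapIncl k A 𝔤) H) →ₐ[k] C,
      ∀ i a, φ (ι k (hElem b i a)) = g i a := by
  classical
  -- Any linear extensions of the fundamental weights to 𝔤 will do, since only the restriction of
  -- `G` to `L₀` is used. Being a Lie homomorphism is automatic there: `L₀` is abelian and `C` is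
  -- commutative.
  choose ξ hξ using fun i => LinearMap.exists_extend (p := H.toSubmodule) (fundamentalWeight b i)
  let G : A ⊗[k] 𝔤 →ₗ[k] C := ∑ i, TensorProduct.lift ((LinearMap.lsmul k C).flip ∘ₗ g i |>.compl₂ (ξ i))
  have hG : ∀ i a, G (hElem (k := k) b i a : A ⊗[k] 𝔤) = g i a := by
    intro i a
    have h1 : ∀ i', ξ i' (((rootSystem H).coroot i : H) : 𝔤) = if i' = i then 1 else 0 := by
      intro i'
      rw [← fundamentalWeight_coroot b i' i, ← hξ i']
      rfl
    change G (a ⊗ₜ[k] (((rootSystem H).coroot i : H) : 𝔤)) = _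
    have h2 : ∀ x : 𝔤, G (a ⊗ₜ[k] x) = ∑ i', ξ i' x • g i' a := fun x => by simp [G]
    rw [h2]
    simp only [h1, ite_smul, one_smul, zero_smul, Finset.sum_ite_eq', Finset.mem_univ, if_true]
  let F : zeroPart (mapIncl k A 𝔤) H →ₗ⁅k⁆ C :=
    { toLinearMap := G ∘ₗ (zeroPart (mapIncl k A 𝔤) H).toSubmodule.subtype
      map_lie' := fun {x y} => by
        rw [lie_zeroPart b, LieRing.of_associative_ring_bracket, mul_comm, sub_self]
        exact map_zero _ }
  exact ⟨lift k F, fun i a => by rw [lift_ι_apply]; exact hG i a⟩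

end Harish

end Seligman

namespace Seligman

open LieAlgebra.IsKilling Module UniversalEnvelopingAlgebra SymTensor

attribute [local instance 100] LieRing.ofAssociativeRing

/-! ### The homomorphism from the Seligman algebra to symmetric tensors. -/

section Iso

variable {k A 𝔤 : Type*} [Field k] [CharZero k] [CommRing A] [Algebra k A]
  [LieRing 𝔤] [LieAlgebra k 𝔤] [FiniteDimensional k 𝔤] [LieAlgebra.IsSemisimple k 𝔤]
  {H : LieSubalgebra k 𝔤} [H.IsCartanSubalgebra] [LieModule.IsTriangularizable k H 𝔤]
  (b : (rootSystem H).Base)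

theorem inFactor_eq {I : Type*} [DecidableEq I] (l : I → ℕ) (i : I) (t : TS k A (l i)) :
    inFactor l i t =
      PiTensorProduct.singleAlgHom (R := k) (A := fun i => TS k A (l i)) i t := by
  rw [inFactor, PiTensorProduct.singleAlgHom_apply]
  congr 1
  ext i'
  by_cases h : i' = i
  · subst h; simp
  · simp [h]

/-- The homomorphism `U(L₀) → TS^λ(A)` annihilates the kernel of the projection of `U(L)₀` modulo
`U(L) L₊`. -/
theorem eq_zero_of_envIncl_mem (l : b.support → ℕ)
    (φ : UniversalEnvelopingAlgebra k (zeroPart (mapIncl k A 𝔤) H) →ₐ[k] TSAlg k A l)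
    (hφ : ∀ i a, φ (ι k (hElem b i a)) = inFactor l i (sym k (l i) a))
    (u : UniversalEnvelopingAlgebra k (zeroPart (mapIncl k A 𝔤) H))
    (hu : envIncl (mapIncl k A 𝔤) H u ∈ envPos (mapIncl k A 𝔤) H (posRoots b)) : φ u = 0 := by
  classical
  -- In the full tensor algebra `φ` becomes a sum over points: each pair of an `i` and a place `q`
  -- carries the corresponding embedding of `A` and the weight `ϖ_i`.
  let v : ∀ i, TS k A (l i) →ₐ[k] ⨂[k] _ : Fin (l i), A := fun i => (TS k A (l i)).val
  have hinj := PiTensorProduct.mapAlg_injective v fun i => Subtype.val_injective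
  apply hinj
  rw [map_zero]
  let single := fun i : b.support =>
    PiTensorProduct.singleAlgHom (R := k) (A := fun i => ⨂[k] _ : Fin (l i), A) i
  refine eq_zero_of_mem_envPos b (Q := Σ i, Fin (l i))
    (fun q => (single q.1).comp (placeHom k (l q.1) q.2)) (fun q => fundamentalWeight b q.1)
    ((PiTensorProduct.mapAlg v).comp φ) (fun i a => ?_) u hu
  rw [AlgHom.comp_apply, hφ, inFactor_eq, PiTensorProduct.mapAlg_single, Fintype.sum_sigma,
    Finset.sum_eq_single i]
  · simp only [fundamentalWeight_coroot, if_true, map_one, mul_one]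
    change single i (∑ q, place k (l i) q a) = ∑ q, single i (placeHom k (l i) q a)
    simp only [placeHom_apply]
    exact map_sum (single i) _ _
  · intro i' _ h
    refine Finset.sum_eq_zero fun q _ => ?_
    rw [fundamentalWeight_coroot, if_neg h, map_zero, mul_zero]
  · simp

theorem map_psi_eq_zero (l : b.support → ℕ)
    (φ : UniversalEnvelopingAlgebra k (zeroPart (mapIncl k A 𝔤) H) →ₐ[k] TSAlg k A l)
    (hφ : ∀ i a, φ (ι k (hElem b i a)) = inFactor l i (sym k (l i) a)) (i : b.support)
    (c : Fin (l i + 1) → A) : φ (psi (hCurrent b i) (l i + 1) c) = 0 := by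
  classical
  have h : φ.toLinearMap ∘ₗ hCurrent b i =
      (PiTensorProduct.singleAlgHom (R := k) (A := fun i => TS k A (l i)) i).toLinearMap ∘ₗ
        symLin k (l i) := by
    ext a
    exact (hφ i a).trans (inFactor_eq l i _)
  refine (psi_map (C' := TSAlg k A l) φ (hCurrent b i) (l i + 1) c).trans ?_
  refine (congrArg (fun g => psi g (l i + 1) c) h).trans ((psi_map _ (symLin k (l i)) _ c).symm.trans ?_)
  rw [psi_sym_succ]
  exact map_zero _

theorem map_isGenerator_eq_zero (l : b.support → ℕ) (lam : Dual k H)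
    (hlam : ∀ i : b.support, lam ((rootSystem H).coroot i) = l i)
    (φ : UniversalEnvelopingAlgebra k (zeroPart (mapIncl k A 𝔤) H) →ₐ[k] TSAlg k A l)
    (hφ : ∀ i a, φ (ι k (hElem b i a)) = inFactor l i (sym k (l i) a))
    {u : UniversalEnvelopingAlgebra k (zeroPart (mapIncl k A 𝔤) H)}
    (hu : IsGenerator b (mapIncl k A 𝔤) (posRoots b) lam u) : φ u = 0 := by
  classical
  cases hu with
  | hc i l' hl m β x y hβ hx hy hsum _ hHC =>
    obtain rfl : l' = l i := by
      have := hl.symm.trans (hlam i)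
      exact_mod_cast this
    obtain ⟨rfl, hβ'⟩ := eq_simple_of_sum_eq b i β hβ hsum
    obtain ⟨e, f, t, he, hf, hxe, hyf⟩ := exists_simple_triple (A := A) b i
    choose a ha using fun q => hxe (x q) (by rw [← hβ' q]; exact hx q)
    choose c hc using fun q => hyf (y q) (hy q)
    obtain ⟨p, hp, hpc⟩ := exists_psi_congr b i t he a c
    have h1 := hHC.2.1
    have h2 : (List.ofFn fun q => ι k (x q)).prod * (List.ofFn fun q => ι k (y q)).prod =
        ordProd (current k A e) a * ordProd (current k A f) c := by
      simp only [ha, hc]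
      rfl
    rw [h2] at h1
    -- Both `u` and the Ψ-combination `p` represent the same product modulo `U(L) L₊`. Their
    -- difference is killed by `φ`, so `φ u = φ p = 0`.
    have h3 : envIncl (mapIncl k A 𝔤) H (p - u) ∈
        envPos (mapIncl k A 𝔤) H (posRoots b) := by
      have := Submodule.sub_mem _ h1 hpc
      rw [sub_sub_sub_cancel_left] at this
      rw [map_sub]
      exact this
    have h4 := eq_zero_of_envIncl_mem b l φ hφ _ h3
    have h5 : Submodule.span k (Set.range (psi (hCurrent b i) (l i + 1))) ≤
        LinearMap.ker φ.toLinearMap := by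
      rw [Submodule.span_le]
      rintro _ ⟨c, rfl⟩
      exact map_psi_eq_zero b l φ hφ i c
    have h6 : φ p = 0 := h5 hp
    exact (sub_eq_zero.1 ((map_sub φ p u).symm.trans h4)).symm.trans h6
  | wt i =>
    have h1 : hElem (k := k) b i (1 : A) =
      ⟨mapIncl k A 𝔤 ((rootSystem H).coroot i), map_mem_zeroPart _ _⟩ := rfl
    rw [map_sub, ← h1, hφ, sym_one, inFactor_eq, map_natCast, AlgHom.commutes, hlam, map_natCast,
      sub_self]

theorem can_surjective (lam : Dual k H) :
    Function.Surjective (can b (mapIncl k A 𝔤) (posRoots b) lam) :=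
  RingCon.mkₐ_surjective _

theorem can_algHom_ext (lam : Dual k H) {C : Type*} [Ring C] [Algebra k C]
    {f g : Alg b (mapIncl k A 𝔤) (posRoots b) lam →ₐ[k] C}
    (h : ∀ i a, f (can b (mapIncl k A 𝔤) (posRoots b) lam (ι k (hElem b i a))) =
      g (can b (mapIncl k A 𝔤) (posRoots b) lam (ι k (hElem b i a)))) : f = g := by
  refine RingCon.Quotient.hom_extₐ (UniversalEnvelopingAlgebra.hom_ext k ?_)
  refine LieHom.ext fun x => LinearMap.congr_fun (f := (f.toLinearMap ∘ₗ
    (can b (mapIncl k A 𝔤) (posRoots b) lam).toLinearMap) ∘ₗ (ι k).toLinearMap)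
    (g := (g.toLinearMap ∘ₗ
    (can b (mapIncl k A 𝔤) (posRoots b) lam).toLinearMap) ∘ₗ (ι k).toLinearMap)
    (LinearMap.ext_on (span_hElem A b) ?_) x
  rintro _ ⟨⟨i, a⟩, rfl⟩
  exact h i a

end Iso

end Seligman

end

theorem theorem5p7 {k 𝔤 A : Type*} [Field k] [CharZero k]
    [LieRing 𝔤] [LieAlgebra k 𝔤] [FiniteDimensional k 𝔤] [LieAlgebra.IsSemisimple k 𝔤]
    (H : LieSubalgebra k 𝔤) [H.IsCartanSubalgebra] [LieModule.IsTriangularizable k H 𝔤]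
    (b : (LieAlgebra.IsKilling.rootSystem H).Base)
    [CommRing A] [Algebra k A]
    (l : b.support → ℕ) (lam : Module.Dual k H)
    (hlam : lam = ∑ i, l i • Seligman.fundamentalWeight b i) :
    ∃ Φ : Seligman.Alg b (Seligman.mapIncl k A 𝔤) (Seligman.posRoots b) lam ≃ₐ[k]
        Seligman.TSAlg k A l,
      ∀ (i : b.support) (a : A),
        Φ (Seligman.can b (Seligman.mapIncl k A 𝔤) (Seligman.posRoots b) lam
            (UniversalEnvelopingAlgebra.ι k (Seligman.hElem b i a))) =
          Seligman.inFactor l i (SymTensor.sym k (l i) a) := by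
  classical
  have hl : ∀ i : b.support, lam ((LieAlgebra.IsKilling.rootSystem H).coroot i) = l i := by
    intro i
    simp [hlam, LinearMap.sum_apply, Seligman.fundamentalWeight_coroot,
      -LieAlgebra.IsKilling.rootSystem_coroot_apply]
  let single := fun i : b.support =>
    PiTensorProduct.singleAlgHom (R := k) (A := fun i => SymTensor.TS k A (l i)) i
  obtain ⟨φ, hφ⟩ := Seligman.exists_envZero_algHom (A := A) (C := Seligman.TSAlg k A l) b
    fun i => (single i).toLinearMap ∘ₗ SymTensor.symLin k (l i)
  have hφ' : ∀ i a, φ (UniversalEnvelopingAlgebra.ι k (Seligman.hElem b i a)) =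
      Seligman.inFactor l i (SymTensor.sym k (l i) a) := fun i a =>
    (hφ i a).trans (Seligman.inFactor_eq l i _).symm
  let Φ : Seligman.Alg b (Seligman.mapIncl k A 𝔤) (Seligman.posRoots b) lam →ₐ[k]
      Seligman.TSAlg k A l := RingCon.liftₐ _ φ (by
    have hle : Seligman.ideal b (Seligman.mapIncl k A 𝔤) (Seligman.posRoots b) lam ≤
        TwoSidedIdeal.ker φ := TwoSidedIdeal.span_le.2 fun u hu =>
      (TwoSidedIdeal.mem_ker φ).2 (Seligman.map_isGenerator_eq_zero b l lam hl φ hφ' hu)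
    intro x y hxy
    have := hle ((TwoSidedIdeal.rel_iff _ x y).1 hxy)
    exact sub_eq_zero.1 ((map_sub φ x y).symm.trans ((TwoSidedIdeal.mem_ker φ).1 this)))
  have hΦ : ∀ u, Φ (Seligman.can b (Seligman.mapIncl k A 𝔤) (Seligman.posRoots b) lam u) = φ u :=
    fun _ => rfl
  -- The inverse is built factor by factor from the presentation of `TS^ℓ(A)`. Commutativity of the
  -- Seligman algebra, inherited from `U(L₀)`, lets the factors be multiplied together.
  have hχ : ∀ i, ∃ χ : SymTensor.TS k A (l i) →ₐ[k]
      Seligman.Alg b (Seligman.mapIncl k A 𝔤) (Seligman.posRoots b) lam,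
      ∀ a, χ (SymTensor.sym k (l i) a) =
        Seligman.can b (Seligman.mapIncl k A 𝔤) (Seligman.posRoots b) lam
          (Seligman.hCurrent b i a) := fun i =>
    SymTensor.exists_lift (l i)
      ((Seligman.can b (Seligman.mapIncl k A 𝔤) (Seligman.posRoots b) lam).toLinearMap ∘ₗ
        Seligman.hCurrent b i) (Seligman.can_hCurrent_one b lam i (l i) (hl i)) fun c => by
          rw [← SymTensor.psi_map]
          exact Seligman.can_psi_eq_zero b lam i (l i) (hl i) c
  choose χ hχ using hχ
  have hcomm : ∀ x y : Seligman.Alg b (Seligman.mapIncl k A 𝔤) (Seligman.posRoots b) lam,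
      x * y = y * x := by
    intro x y
    obtain ⟨u, rfl⟩ := Seligman.can_surjective b lam x
    obtain ⟨v, rfl⟩ := Seligman.can_surjective b lam y
    rw [← map_mul, Seligman.mul_comm_env b, map_mul]
  obtain ⟨Ψ, hΨ⟩ := PiTensorProduct.exists_algHom hcomm χ
  have h1 : Φ.comp Ψ = AlgHom.id k _ := by
    refine PiTensorProduct.algHom_ext fun i =>
      AlgHom.ext_of_adjoin_eq_top (SymTensor.adjoin_sym k (l i)) ?_
    rintro _ ⟨a, rfl⟩
    simp only [AlgHom.comp_apply, AlgHom.id_apply]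
    rw [hΨ, hχ, hΦ]
    exact hφ i a
  have h2 : Ψ.comp Φ = AlgHom.id k _ := by
    refine Seligman.can_algHom_ext b lam fun i a => ?_
    rw [AlgHom.comp_apply, AlgHom.id_apply, hΦ, hφ', Seligman.inFactor_eq, hΨ, hχ]
    rfl
  exact ⟨AlgEquiv.ofAlgHom Φ Ψ h1 h2, fun i a => hφ' i a⟩
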